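/- Let $m\ge 1$ and $n\ge 0$. An $m$-ballot path of size $n$ is a path from $(0,0)$ to $(mn,n)$ with vertical and horizontal unit steps, weakly above the line $y=x/m$ (for $m=1$: a Dyck path, with up steps and down steps). The $m$-Tamari lattice on these paths is the reflexive transitive closure of rotation, which exchanges a horizontal step followed by a vertical one with the portion of the path that follows it, up to the first return to the line of slope $1/m$ through the end of that horizontal step. Its intervals $I=[P,Q]$, $P\le Q$, are the $m$-Tamari intervals of size $n$ (for $m=1$: Tamari intervals). The $m$-rise vector of $I$ is read on $Q$: $r_0$ (the initial rise) is the number of initial vertical steps, and $r_i$, $1\le i\le mn-1$, is the number of vertical steps directly after the $i$-th horizontal step. The $m$-contact vector of $I$ is read on $P$: $c_0$ is the number of non-final contacts of $P$ with $y=x/m$, and it is followed, for each vertical step from $(a,b)$ to $(a,b+1)$, from left to right, and each $j=1,\dots,m$, by the number of non-final contacts between the line of slope $1/m$ through $(a,b+j/m)$ and the portion of $P$ that starts at $(a,b+1)$ and stays weakly above this line; the very last of these numbers, which is always $0$, is omitted. Both vectors have length $mn$. The distance of $I$ is the maximal length of a chain from $P$ to $Q$ in the $m$-Tamari lattice. Dyck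 paths of size $N$ are identified with binary trees with $N$ nodes by $D(\emptyset)=\emptyset$, $D(L,R)=D(L)\,1\,D(R)\,0$ ($1$ = up, $0$ = down), where $L,R$ are the left and right subtrees; nodes are numbered in in-order. A grafting tree is a binary tree with labels $\ell(v)\in\mathbb N$ on its nodes such that $\ell(v)\le \mathrm{size}(T_R(v))-\sum_{w\in T_R(v)}\ell(w)$ for every node $v$, where $T_R(v)$ is the right subtree of $v$. The grafting tree of a Tamari interval $[S,T]$ of binary trees is $T$ with its $i$-th node labeled by the number of nodes on the left branch of the right subtree of the $i$-th node of $S$. Replacing each vertical step by $m$ up steps turns an $m$-Tamari interval of size $n$ into a Tamari interval of size $nm$ and so gives it a grafting tree of size $nm$. An $m$-grafting tree of size $nm$ is a grafting tree of size $nm$ whose $i$-th node has a label $\ge 1$ whenever $m\nmid i$. The map $\mathrm{expand}$ replaces the label $\ell$ of the $i$-th node by $m\ell$ if $m\mid i$ and by $m(\ell-1)$ otherwise; the map $\mathrm{contract}$ replaces it by $\ell/m$ if $m\mid i$ and by $\ell/m+1$ otherwise (with integer quotients). Let $\Psi([S,T])=[\overline T,\overline S]$, where the bar is the mirror image of binary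 trees; let $\Phi$ be the map on Tamari intervals that reverses, in the grafting tree, the order of the nodes on every left branch, each node keeping its label and its (recursively transformed) right subtree; and let $\beta=\Phi\circ\Psi\circ\Phi$ be the rise-contact involution. Identifying intervals with their grafting trees, let $\beta_m$ be the map on $m$-Tamari intervals that first applies $\mathrm{expand}$, then $\beta$, then $\mathrm{contract}$. **Theorem.** 1. Sending an $m$-Tamari interval to its grafting tree is a bijection from the $m$-Tamari intervals of size $n$ onto the $m$-grafting trees of size $nm$. 2. $\mathrm{expand}$ and $\mathrm{contract}$ are mutually inverse bijections between the $m$-grafting trees of size $nm$ and the grafting trees of size $nm$ whose Tamari interval (of size $nm$) has a contact vector and a rise vector with all entries divisible by $m$. 3. $\beta_m$ is an involution on the $m$-Tamari intervals of size $n$. It exchanges $c_0$ with the initial rise $r_0$, it exchanges the multiset of the entries of the $m$-contact vector with the multiset of the entries of the $m$-rise vector, and it preserves the distance. 4. Consequently (Préville-Ratelle's Conjecture 17) the joint distribution over the $m$-Tamari intervals of size $n$ of the $m$-contacts ($c_0$ and the multiset of all entries) and of the $m$-rises ($r_0$ and the multiset of all entries), together with the distance, is symmetric in contacts and rises: for all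 $a,b,d$ and multisets $A,B$, the number of intervals with $c_0=a$, contacts $A$, $r_0=b$, rises $B$ and distance $d$ equals the number with $c_0=b$, contacts $B$, $r_0=a$, rises $A$ and distance $d$. -/

import Mathlib

namespace MTamari

/-! ### Paths, the `m`-Tamari order, intervals and their statistics -/

/-- A lattice path, as a word: `true` is a vertical (or up) step and `false` is a horizontal
(or down) step. -/
abbrev Path := List Bool

/-- `w` is an `m`-ballot path of size `n`: a path from `(0,0)` to `(mn,n)`, with `n` vertical and
`mn` horizontal steps, that stays weakly above the line `y = x / m`.
For `m = 1` these are the Dyck paths of size `n`. -/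
def IsBallotPath (m n : ℕ) (w : Path) : Prop :=
  w.count true = n ∧ w.count false = m * n ∧
    ∀ u : Path, u <+: w → u.count false ≤ m * u.count true

/-- `b` is the portion of a path between a point followed by a vertical step and the first later
point on the line of slope `1/m` through it. -/
def IsExcursion (m : ℕ) (b : Path) : Prop :=
  b ≠ [] ∧ b.count false = m * b.count true ∧
    ∀ u : Path, u <+: b → u ≠ [] → u ≠ b → u.count false < m * u.count true

/-- The rotation of `m`-ballot paths: a horizontal step is exchanged with the excursion that
follows it. -/
def Rotation (m : ℕ) (w w' : Path) : Prop :=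
  ∃ a b c : Path, IsExcursion m b ∧ w = a ++ false :: (b ++ c) ∧ w' = a ++ (b ++ false :: c)

/-- The `m`-Tamari order: the reflexive transitive closure of rotation. -/
def TamariLE (m : ℕ) : Path → Path → Prop :=
  Relation.ReflTransGen (Rotation m)

/-- The intervals `[P, Q]` of the `m`-Tamari lattice on `m`-ballot paths of size `n`, each given by
the pair `(P, Q)` of its lower and its upper path. -/
def intervals (m n : ℕ) : Set (Path × Path) :=
  {I | IsBallotPath m n I.1 ∧ IsBallotPath m n I.2 ∧ TamariLE m I.1 I.2}

/-- The distance of an interval: the largest `k` for which there is a chain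
`P = c₀ < c₁ < ⋯ < c_k = Q` in the `m`-Tamari order. -/
noncomputable def distance (m : ℕ) (I : Path × Path) : ℕ :=
  sSup {k | ∃ c : ℕ → Path, c 0 = I.1 ∧ c k = I.2 ∧
    ∀ i < k, TamariLE m (c i) (c (i + 1)) ∧ c i ≠ c (i + 1)}

/-- The number of consecutive vertical steps at the beginning of a path. -/
def initialRise (w : Path) : ℕ := (w.takeWhile (· = true)).length

/-- Auxiliary to `riseVector`; the first argument is the number of vertical steps read since the
last horizontal one. -/
def riseVectorAux : ℕ → Path → List ℕ
  | _, [] => []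
  | k, true :: w => riseVectorAux (k + 1) w
  | k, false :: w => k :: riseVectorAux 0 w

/-- The rise vector `(r₀, r₁, …)` of a path that ends with a horizontal step: `r₀` is the
number of initial vertical steps and `rᵢ` is the number of vertical steps that directly follow the
`i`-th horizontal step (the last horizontal step, which ends the path, is not taken into account).
An `m`-ballot path of size `n` has a rise vector of length `mn`. -/
def riseVector (w : Path) : List ℕ := riseVectorAux 0 w

/-- `contactsFrom m h w`: the path `w` starts at height `h / m` above a line of slope `1/m`;
this is the number of vertical steps of `w` that start on the line before `w` goes
strictly below it. The first argument after `m` is the current height, in units of `1/m`. -/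
def contactsFrom (m : ℕ) : ℕ → Path → ℕ
  | _, [] => 0
  | h, true :: w => (if h = 0 then 1 else 0) + contactsFrom m (h + m) w
  | 0, false :: _ => 0
  | h + 1, false :: w => contactsFrom m h w

/-- The number of vertical steps of a path that start on the line `y = x / m`. For an `m`-ballot
path it is the number of contacts with this line other than the final one, or equivalently
other than the initial one. -/
def contactValue (m : ℕ) (w : Path) : ℕ := contactsFrom m 0 w

/-- The contacts of the vertical steps of a path, from left to right. Each vertical step, from
`(a, b)` to `(a, b + 1)`, has `m` of them, for `j = 1, …, m`: the number of contacts, the last one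
excepted, between the line of slope `1/m` through `(a, b + j/m)` and the portion of the path that
starts at `(a, b + 1)` and is weakly above this line. -/
def innerContacts (m : ℕ) : Path → List ℕ
  | [] => []
  | true :: w => (List.range m).map (fun j => contactsFrom m (m - (j + 1)) w) ++ innerContacts m w
  | false :: w => innerContacts m w

/-- The `m`-contact vector, of length `mn` for an `m`-ballot path of size `n`: the contact value,
followed by the contacts of the vertical steps, without the very last one, which is always `0`. -/
def contactVector (m : ℕ) (w : Path) : List ℕ :=
  (contactValue m w :: innerContacts m w).dropLast

/-- The multiset of the `m`-contacts of an interval (read on its lower path). -/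
def contacts (m : ℕ) (I : Path × Path) : Multiset ℕ := (contactVector m I.1 : Multiset ℕ)

/-- The multiset of the `m`-rises of an interval (read on its upper path). -/
def rises (I : Path × Path) : Multiset ℕ := (riseVector I.2 : Multiset ℕ)

/-! ### Binary trees, Dyck paths and `m`-ballot paths -/

/-- The Dyck path of a binary tree: `D(∅)` is empty, and a tree with left subtree `L` and right
subtree `R` has Dyck path `D(L) 1 D(R) 0`. The `i`-th up step corresponds to the `i`-th node in
in-order, and rotation of Dyck paths corresponds to the right rotation of binary trees. -/
def treeToDyck : BinaryTree Unit → Path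
  | .nil => []
  | .node _ l r => treeToDyck l ++ true :: (treeToDyck r ++ [false])

/-- Auxiliary to `dyckToTree`: reads a path with a stack of trees. -/
def dyckToTreeAux : List (BinaryTree Unit) → Path → BinaryTree Unit
  | [], [] => .nil
  | t :: _, [] => t
  | s, true :: w => dyckToTreeAux (.nil :: s) w
  | r :: l :: s, false :: w => dyckToTreeAux (.node () l r :: s) w
  | _, false :: _ => .nil

/-- The binary tree of a Dyck path, inverse to `treeToDyck`. -/
def dyckToTree (w : Path) : BinaryTree Unit := dyckToTreeAux [.nil] w

/-- The Dyck path of size `mn` of an `m`-ballot path of size `n`: every vertical step is replaced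
by `m` up steps. -/
def ballotToDyck (m : ℕ) (w : Path) : Path :=
  w.flatMap fun s => if s then List.replicate m true else [false]

/-- Inverse to `ballotToDyck m`: the length of every maximal sequence of up steps is divided
by `m`. -/
def dyckToBallot (m : ℕ) (w : Path) : Path :=
  (riseVector w).flatMap fun r => List.replicate (r / m) true ++ [false]

/-! ### Grafting trees -/

/-- The sum of the labels of a labeled binary tree. -/
def labelSum : BinaryTree ℕ → ℕ
  | .nil => 0
  | .node x l r => labelSum l + x + labelSum r

/-- Grafting trees: labeled binary trees in which the label of each node is at most the size of
its right subtree minus the sum of the labels of its right subtree. -/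
def IsGraftingTree : BinaryTree ℕ → Prop
  | .nil => True
  | .node x l r => x + labelSum r ≤ r.numNodes ∧ IsGraftingTree l ∧ IsGraftingTree r

/-- The list of the labels of a labeled binary tree, in in-order. -/
def labels : BinaryTree ℕ → List ℕ
  | .nil => []
  | .node x l r => labels l ++ x :: labels r

/-- The binary tree that underlies a labeled binary tree. -/
def shape (G : BinaryTree ℕ) : BinaryTree Unit := G.map fun _ => ()

/-- Labels the nodes of a binary tree, in in-order, with the elements of a list. -/
def relabel : BinaryTree Unit → List ℕ → BinaryTree ℕ
  | .nil, _ => .nil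
  | .node _ l r, x =>
      .node (x.getD l.numNodes 0) (relabel l (x.take l.numNodes))
        (relabel r (x.drop (l.numNodes + 1)))

/-- The number of nodes on the left branch of a binary tree. -/
def leftBranchLength : BinaryTree Unit → ℕ
  | .nil => 0
  | .node _ l _ => leftBranchLength l + 1

/-- For each node `i` of a binary tree, in in-order, the number of children of `i` in the
decreasing forest of the tree (left sibling - right child), that is the number of nodes on
the left branch of the right subtree of `i`. -/
def childCounts : BinaryTree Unit → List ℕ
  | .nil => []
  | .node _ l r => childCounts l ++ leftBranchLength r :: childCounts r

/-- The grafting tree of a Tamari interval, given as a pair of binary trees: the shape is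
the upper tree and the label of the node `i` is the number of children of `i` in the decreasing
forest of the lower tree. -/
def graft (I : BinaryTree Unit × BinaryTree Unit) : BinaryTree ℕ :=
  relabel I.2 (childCounts I.1)

/-- The binary tree with a left branch that carries, from its bottom to its top, the given right
subtrees. -/
def comb (F : List (BinaryTree Unit)) : BinaryTree Unit :=
  F.foldl (fun t r => .node () t r) .nil

/-- The planar forest with nodes `1, …, n` in preorder in which the node `i` has the given number
of children. A tree of the forest is given by the forest of the descendants of its root, as a
binary tree in the left sibling - right child encoding. -/
def forestOfChildCounts : List ℕ → List (BinaryTree Unit)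
  | [] => []
  | k :: x => comb ((forestOfChildCounts x).take k) :: (forestOfChildCounts x).drop k

/-- The lower binary tree of the interval encoded by a grafting tree: the tree whose decreasing
forest has the labels as numbers of children. -/
def lowerTree (G : BinaryTree ℕ) : BinaryTree Unit := comb (forestOfChildCounts (labels G))

/-- The Tamari interval of a grafting tree, inverse to `graft`. -/
def ungraft (G : BinaryTree ℕ) : BinaryTree Unit × BinaryTree Unit := (lowerTree G, shape G)

/-- The grafting tree of an interval of the `m`-Tamari lattice. -/
def graftingTree (m : ℕ) (I : Path × Path) : BinaryTree ℕ :=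
  graft (dyckToTree (ballotToDyck m I.1), dyckToTree (ballotToDyck m I.2))

/-- The interval of the `m`-Tamari lattice of an `m`-grafting tree. -/
def intervalOf (m : ℕ) (G : BinaryTree ℕ) : Path × Path :=
  (dyckToBallot m (treeToDyck (ungraft G).1), dyckToBallot m (treeToDyck (ungraft G).2))

/-- The `m`-grafting trees of size `nm`: the grafting trees of size `nm` in which the `i`-th node
in in-order has a positive label whenever `m` does not divide `i`. -/
def mGraftingTrees (m n : ℕ) : Set (BinaryTree ℕ) :=
  {G | IsGraftingTree G ∧ G.numNodes = n * m ∧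
    ∀ i, 1 ≤ i → i ≤ n * m → ¬ m ∣ i → 1 ≤ (labels G).getD (i - 1) 0}

/-- The grafting trees of size `nm` such that all the entries of the contact vector and of the rise
vector of the corresponding Tamari interval (of Dyck paths) are multiples of `m`. -/
def mDivisibleGraftingTrees (m n : ℕ) : Set (BinaryTree ℕ) :=
  {G | IsGraftingTree G ∧ G.numNodes = n * m ∧
    (∀ c ∈ contactVector 1 (treeToDyck (ungraft G).1), m ∣ c) ∧
    ∀ r ∈ riseVector (treeToDyck (ungraft G).2), m ∣ r}

/-- `expand`: the label `ℓ` of the `i`-th node in in-order becomes `mℓ` if `m` divides `i`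
and `m(ℓ - 1)` otherwise. -/
def expand (m : ℕ) (G : BinaryTree ℕ) : BinaryTree ℕ :=
  relabel (shape G) ((labels G).mapIdx fun k x => if m ∣ k + 1 then m * x else m * (x - 1))

/-- `contract`: the label `ℓ` of the `i`-th node in in-order becomes `ℓ / m` if `m` divides `i`
and `ℓ / m + 1` otherwise. -/
def contract (m : ℕ) (G : BinaryTree ℕ) : BinaryTree ℕ :=
  relabel (shape G) ((labels G).mapIdx fun k x => if m ∣ k + 1 then x / m else x / m + 1)

/-! ### The involutions -/

/-- The mirror image of a binary tree. -/
def mirror : BinaryTree Unit → BinaryTree Unit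
  | .nil => .nil
  | .node _ l r => .node () (mirror r) (mirror l)

/-- The complement involution `Ψ`. -/
def complement (I : BinaryTree Unit × BinaryTree Unit) : BinaryTree Unit × BinaryTree Unit :=
  (mirror I.2, mirror I.1)

/-- Auxiliary to `reverseLeftBranches`; the second argument is the part already reversed. -/
def reverseLeftBranchesAux : BinaryTree ℕ → BinaryTree ℕ → BinaryTree ℕ
  | .nil, t => t
  | .node x l r, t => reverseLeftBranchesAux l (.node x t (reverseLeftBranchesAux r .nil))

/-- Reverses the order of the nodes on every left branch of a labeled binary tree; every node
keeps its label and its (transformed) right subtree. -/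
def reverseLeftBranches (G : BinaryTree ℕ) : BinaryTree ℕ := reverseLeftBranchesAux G .nil

/-- The left-branch involution `Φ` on Tamari intervals. -/
def leftBranchInvolution (I : BinaryTree Unit × BinaryTree Unit) :
    BinaryTree Unit × BinaryTree Unit :=
  ungraft (reverseLeftBranches (graft I))

/-- The rise-contact involution `β = Φ ∘ Ψ ∘ Φ` on Tamari intervals. -/
def riseContact (I : BinaryTree Unit × BinaryTree Unit) : BinaryTree Unit × BinaryTree Unit :=
  leftBranchInvolution (complement (leftBranchInvolution I))

/-- The `m`-rise-contact map `β_m` on the intervals of the `m`-Tamari lattice: expand the grafting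
tree of the interval, apply `β`, and contract the resulting grafting tree. -/
def mRiseContact (m : ℕ) (I : Path × Path) : Path × Path :=
  intervalOf m (contract m (graft (riseContact (ungraft (expand m (graftingTree m I))))))

end MTamari

/-! Read a binary tree as a planar forest: the nodes of the left branch are the roots, and each
right subtree is the forest of descendants of its node. Then `stack` is concatenation and
`childCounts` is the preorder degree sequence, which determines the forest.

In a grafting tree, the label of a node says how many trees of the forest built on its right subtree
it takes as children. Taking one more is a rotation, so the total slack `labelDefect` is the length
of a chain from the lower tree to the shape (`rotationChain_labelDefect`). Conversely, undoing a
rotation at the lower tree keeps the shape and raises the slack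
(`exists_graftingTree_of_treeRotation`). Hence grafting trees encode exactly the Tamari intervals,
and the slack is the distance.

Φ keeps the size, the multiset of labels and the slack, hence the contacts, since the number of
roots is the size minus the sum of the labels. In the Dyck path, a run of up steps passes from a
node to the bottom of the left branch of its right subtree; once left branches are reversed this is
the right child, so runs become right branches. Ψ mirrors them into left branches of the lower tree,
where they are contacts. So the contacts of β(I) are the rises of I, and the converse follows
because β is an involution. Mirroring reverses chains, so the slack is kept too.

For general `m`, the Dyck paths of ballot paths are those with all rises divisible by `m`;
equivalently, every node whose index is not a multiple of `m` has a child. In such a tree every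
nonempty subtree ends at a multiple of `m` (`PositiveOffMultiples.dvd`). This alignment makes the
sums of expanded labels telescope: `expand` respects the grafting inequalities in both directions,
multiplies the contacts by `m`, and changes the slack by an affine map that depends only on `m` and
`n`. Its image is cut out by divisibility of contacts and rises, a condition that β preserves
because it swaps the two. So β_m is a conjugate of the restriction of β, and its properties follow
after cancelling `m`. -/

namespace MTamari

/-! ### Binary trees as planar forests -/

/-- The tree `v` with the tree `u` attached at the bottom of its left branch. -/
def stack {α : Type*} (u : BinaryTree α) : BinaryTree α → BinaryTree α
  | .nil => u
  | .node x l r => .node x (stack u l) r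

@[simp] theorem nil_stack {α : Type*} (v : BinaryTree α) : stack .nil v = v := by
  induction v with
  | nil => rfl
  | node x l r hl _ => simp [stack, hl]

@[simp] theorem stack_nil {α : Type*} (u : BinaryTree α) : stack u .nil = u := rfl

theorem stack_assoc {α : Type*} (u v w : BinaryTree α) : stack (stack u v) w = stack u (stack v w) := by
  induction w with
  | nil => rfl
  | node x l r hl _ => simp [stack, hl]

theorem node_eq_stack (l r : BinaryTree Unit) :
    BinaryTree.node () l r = stack l (.node () .nil r) := rfl

@[simp] theorem leftBranchLength_stack (u v : BinaryTree Unit) :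
    leftBranchLength (stack u v) = leftBranchLength u + leftBranchLength v := by
  induction v with
  | nil => rfl
  | node x l r hl _ => simp [stack, leftBranchLength, hl]; omega

@[simp] theorem childCounts_stack (u v : BinaryTree Unit) :
    childCounts (stack u v) = childCounts u ++ childCounts v := by
  induction v with
  | nil => simp [childCounts]
  | node x l r hl _ => simp [stack, childCounts, hl]

@[simp] theorem length_childCounts (t : BinaryTree Unit) :
    (childCounts t).length = t.numNodes := by
  induction t with
  | nil => rfl
  | node x l r hl hr => simp [childCounts, hl, hr]; omega

theorem leftBranchLength_pos {t : BinaryTree Unit} : 1 ≤ leftBranchLength t ↔ t ≠ .nil := by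
  cases t <;> simp [leftBranchLength]

theorem comb_append (F F' : List (BinaryTree Unit)) : comb (F ++ F') = stack (comb F) (comb F') := by
  induction F' using List.reverseRecOn with
  | nil => simp [comb]
  | append_singleton F' t ih =>
    rw [← List.append_assoc]
    simp only [comb, List.foldl_append (l := _ ++ F'), List.foldl_append (l := F'),
      List.foldl_cons, List.foldl_nil, stack] at ih ⊢
    rw [ih]

@[simp] theorem comb_nil : comb [] = .nil := rfl

@[simp] theorem comb_singleton (t : BinaryTree Unit) : comb [t] = .node () .nil t := rfl

theorem comb_cons (t : BinaryTree Unit) (F : List (BinaryTree Unit)) :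
    comb (t :: F) = stack (.node () .nil t) (comb F) :=
  comb_append [t] F

@[simp] theorem leftBranchLength_comb (F : List (BinaryTree Unit)) :
    leftBranchLength (comb F) = F.length := by
  induction F with
  | nil => rfl
  | cons t F ih => simp [comb_cons, ih, leftBranchLength]; omega

/-- The right subtrees of the nodes of the left branch, from its bottom to its top. -/
def rightSubtrees : BinaryTree Unit → List (BinaryTree Unit)
  | .nil => []
  | .node _ l r => rightSubtrees l ++ [r]

@[simp] theorem comb_rightSubtrees (t : BinaryTree Unit) : comb (rightSubtrees t) = t := by
  induction t with
  | nil => rfl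
  | node x l r hl _ => simp [rightSubtrees, comb_append, hl, ← node_eq_stack]

@[simp] theorem length_rightSubtrees (t : BinaryTree Unit) :
    (rightSubtrees t).length = leftBranchLength t := by
  rw [← leftBranchLength_comb, comb_rightSubtrees]

/-- A degree sequence is decoded from the right: by the time a node is read, the trees to its right
are complete, and it takes the first of them as children. The tail `y` is there for the induction,
in which the right subtree is followed by later trees. -/
theorem forestOfChildCounts_childCounts_append (t : BinaryTree Unit) (y : List ℕ) :
    forestOfChildCounts (childCounts t ++ y) = rightSubtrees t ++ forestOfChildCounts y := by
  induction t generalizing y with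
  | nil => rfl
  | node x l r hl hr =>
    simp only [childCounts, List.append_assoc, List.cons_append, hl, forestOfChildCounts, hr,
      rightSubtrees]
    rw [← length_rightSubtrees]
    simp

theorem comb_forestOfChildCounts_childCounts (t : BinaryTree Unit) :
    comb (forestOfChildCounts (childCounts t)) = t := by
  have := forestOfChildCounts_childCounts_append t []
  simp only [List.append_nil, forestOfChildCounts] at this
  rw [this, comb_rightSubtrees]

theorem childCounts_injective : Function.Injective childCounts := fun s t h => by
  rw [← comb_forestOfChildCounts_childCounts s, h, comb_forestOfChildCounts_childCounts]

/-! ### Labeled trees -/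

@[simp] theorem length_labels (G : BinaryTree ℕ) : (labels G).length = G.numNodes := by
  induction G with
  | nil => rfl
  | node x l r hl hr => simp [labels, hl, hr]; omega

@[simp] theorem numNodes_shape (G : BinaryTree ℕ) : (shape G).numNodes = G.numNodes := by
  induction G with
  | nil => rfl
  | node x l r hl hr => simp_all [shape, BinaryTree.map]

@[simp] theorem shape_nil : shape .nil = .nil := rfl

@[simp] theorem shape_node (x : ℕ) (l r : BinaryTree ℕ) :
    shape (.node x l r) = .node () (shape l) (shape r) := rfl

@[simp] theorem shape_eq_nil {G : BinaryTree ℕ} : shape G = .nil ↔ G = .nil := by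
  cases G <;> simp

theorem labelSum_eq (G : BinaryTree ℕ) : labelSum G = (labels G).sum := by
  induction G with
  | nil => rfl
  | node x l r hl hr => simp [labels, labelSum, hl, hr]; omega

theorem relabel_shape_labels (G : BinaryTree ℕ) : relabel (shape G) (labels G) = G := by
  induction G with
  | nil => rfl
  | node x l r hl hr =>
    have h : (labels l ++ x :: labels r).drop (l.numNodes + 1) = labels r := by
      rw [← length_labels, List.drop_append]; simp
    have h' : (labels l ++ x :: labels r).take l.numNodes = labels l := by
      rw [← length_labels]; simp
    have h'' : (labels l ++ x :: labels r).getD l.numNodes 0 = x := by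
      rw [← length_labels]; simp
    simp only [shape_node, labels, relabel, numNodes_shape, h, h', h'', hl, hr]

theorem ext_of_shape_of_labels {G H : BinaryTree ℕ} (h : shape G = shape H)
    (h' : labels G = labels H) : G = H := by
  rw [← relabel_shape_labels G, h, h', relabel_shape_labels]

@[simp] theorem shape_relabel (t : BinaryTree Unit) (x : List ℕ) : shape (relabel t x) = t := by
  induction t generalizing x with
  | nil => rfl
  | node u l r hl hr => simp [relabel, hl, hr]

theorem labels_relabel (t : BinaryTree Unit) (x : List ℕ) (h : x.length = t.numNodes) :
    labels (relabel t x) = x := by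
  induction t generalizing x with
  | nil => simpa [relabel, labels, eq_comm] using h
  | node u l r hl hr =>
    simp only [BinaryTree.numNodes] at h
    simp only [relabel, labels]
    rw [hl _ (by simp; omega), hr _ (by simp; omega)]
    have h1 : l.numNodes < x.length := by omega
    rw [List.getD_eq_getElem _ _ h1, List.getElem_cons_drop, List.take_append_drop]

@[simp] theorem numNodes_relabel (t : BinaryTree Unit) (x : List ℕ) :
    (relabel t x).numNodes = t.numNodes := by
  rw [← numNodes_shape, shape_relabel]

/-! ### Grafting trees and their pairs of trees -/

/-- The grafting inequality says that a node finds enough trees among those decoded from its own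
right subtree, so decoding never reaches past a subtree. The second part counts roots as nodes minus
edges. -/
theorem length_forestOfChildCounts_labels {G : BinaryTree ℕ} (hG : IsGraftingTree G) :
    (∀ y, forestOfChildCounts (labels G ++ y) =
      forestOfChildCounts (labels G) ++ forestOfChildCounts y) ∧
    (forestOfChildCounts (labels G)).length + labelSum G = G.numNodes := by
  induction G with
  | nil => simp [labels, forestOfChildCounts, labelSum]
  | node x l r hl hr =>
    obtain ⟨hx, hGl, hGr⟩ := hG
    obtain ⟨hl1, hl2⟩ := hl hGl
    obtain ⟨hr1, hr2⟩ := hr hGr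
    have hx' : x ≤ (forestOfChildCounts (labels r)).length := by omega
    refine ⟨fun y => ?_, ?_⟩
    · simp only [labels, List.append_assoc, List.cons_append, hl1, forestOfChildCounts, hr1]
      rw [List.take_append_of_le_length hx', List.drop_append_of_le_length hx']
    · simp only [labels, hl1, forestOfChildCounts, labelSum, List.length_append, List.length_cons,
        List.length_drop, BinaryTree.numNodes]
      omega

theorem leftBranchLength_lowerTree {G : BinaryTree ℕ} (hG : IsGraftingTree G) :
    leftBranchLength (lowerTree G) + labelSum G = G.numNodes := by
  simpa [lowerTree] using (length_forestOfChildCounts_labels hG).2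

/-- Recursive form of the lower forest: the root takes the first `x` trees `A` of the forest of `r`
as children, and the others, `B`, become its next siblings. -/
theorem exists_lowerTree_node {x : ℕ} {l r : BinaryTree ℕ} (hG : IsGraftingTree (.node x l r)) :
    ∃ A B, lowerTree r = stack A B ∧ leftBranchLength A = x ∧
      lowerTree (.node x l r) = stack (lowerTree l) (stack (.node () .nil A) B) := by
  obtain ⟨hx, hGl, hGr⟩ := hG
  have hl := (length_forestOfChildCounts_labels hGl).1
  have hr := (length_forestOfChildCounts_labels hGr).2
  refine ⟨comb ((forestOfChildCounts (labels r)).take x),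
    comb ((forestOfChildCounts (labels r)).drop x), ?_, ?_, ?_⟩
  · rw [← comb_append, List.take_append_drop, lowerTree]
  · simp; omega
  · simp only [lowerTree, labels, hl, forestOfChildCounts, comb_append, comb_cons]

theorem childCounts_lowerTree {G : BinaryTree ℕ} (hG : IsGraftingTree G) :
    childCounts (lowerTree G) = labels G := by
  induction G with
  | nil => rfl
  | node x l r hl hr =>
    obtain ⟨A, B, h1, h2, h3⟩ := exists_lowerTree_node hG
    have := hr hG.2.2
    rw [h1, childCounts_stack] at this
    simp [h3, hl hG.2.1, labels, childCounts, h2, ← this]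

theorem numNodes_lowerTree {G : BinaryTree ℕ} (hG : IsGraftingTree G) :
    (lowerTree G).numNodes = G.numNodes := by
  rw [← length_childCounts, childCounts_lowerTree hG, length_labels]

theorem graft_ungraft {G : BinaryTree ℕ} (hG : IsGraftingTree G) : graft (ungraft G) = G := by
  rw [graft, ungraft, childCounts_lowerTree hG, relabel_shape_labels]

theorem labels_graft {S T : BinaryTree Unit} (h : S.numNodes = T.numNodes) :
    labels (graft (S, T)) = childCounts S :=
  labels_relabel _ _ (by simpa using h)

theorem ungraft_graft {S T : BinaryTree Unit} (h : S.numNodes = T.numNodes) :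
    ungraft (graft (S, T)) = (S, T) := by
  rw [ungraft, lowerTree, labels_graft h, comb_forestOfChildCounts_childCounts]
  simp [graft]

/-- The grafting tree with left subtree `G`, right subtree `H` and root labeled by the
number of components of `A`, where `A` and `B` make up the lower tree of `H`. -/
theorem lowerTree_node {G H : BinaryTree ℕ} (hG : IsGraftingTree G) (hH : IsGraftingTree H)
    {A B : BinaryTree Unit} (h : lowerTree H = stack A B) :
    IsGraftingTree (.node (leftBranchLength A) G H) ∧
      lowerTree (.node (leftBranchLength A) G H) =
        stack (lowerTree G) (stack (.node () .nil A) B) := by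
  have hN : IsGraftingTree (.node (leftBranchLength A) G H) := by
    refine ⟨?_, hG, hH⟩
    have := leftBranchLength_lowerTree hH
    rw [h, leftBranchLength_stack] at this
    omega
  refine ⟨hN, childCounts_injective ?_⟩
  have := childCounts_lowerTree hH
  rw [h, childCounts_stack] at this
  simp [childCounts_lowerTree hN, childCounts_lowerTree hG, labels, childCounts, ← this]

/-! ### Rotation of binary trees -/

/-- The right rotation of binary trees. -/
inductive TreeRotation : BinaryTree Unit → BinaryTree Unit → Prop
  | rotate (a b c : BinaryTree Unit) :
      TreeRotation (.node () (.node () a b) c) (.node () a (.node () b c))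
  | left {l l' : BinaryTree Unit} (r : BinaryTree Unit) (h : TreeRotation l l') :
      TreeRotation (.node () l r) (.node () l' r)
  | right (l : BinaryTree Unit) {r r' : BinaryTree Unit} (h : TreeRotation r r') :
      TreeRotation (.node () l r) (.node () l r')

/-- `RotationChain k S T`: the tree `T` is obtained from `S` by a sequence of `k` rotations. -/
inductive RotationChain : ℕ → BinaryTree Unit → BinaryTree Unit → Prop
  | refl (t : BinaryTree Unit) : RotationChain 0 t t
  | head {k : ℕ} {s t u : BinaryTree Unit} (h : TreeRotation s t) (h' : RotationChain k t u) :
      RotationChain (k + 1) s u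

theorem TreeRotation.numNodes_eq {s t : BinaryTree Unit} (h : TreeRotation s t) :
    s.numNodes = t.numNodes := by
  induction h <;> simp <;> omega

theorem RotationChain.numNodes_eq {k : ℕ} {s t : BinaryTree Unit} (h : RotationChain k s t) :
    s.numNodes = t.numNodes := by
  induction h with
  | refl => rfl
  | head h _ ih => exact h.numNodes_eq.trans ih

theorem RotationChain.trans {j k : ℕ} {s t u : BinaryTree Unit} (h : RotationChain j s t)
    (h' : RotationChain k t u) : RotationChain (j + k) s u := by
  induction h with
  | refl => simpa using h'
  | head h _ ih => rw [Nat.add_right_comm]; exact .head h (ih h')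

theorem RotationChain.single {s t : BinaryTree Unit} (h : TreeRotation s t) :
    RotationChain 1 s t := .head h (.refl t)

theorem RotationChain.map {f : BinaryTree Unit → BinaryTree Unit}
    (hf : ∀ {s t}, TreeRotation s t → TreeRotation (f s) (f t)) {k : ℕ} {s t : BinaryTree Unit}
    (h : RotationChain k s t) : RotationChain k (f s) (f t) := by
  induction h with
  | refl => exact .refl _
  | head h _ ih => exact .head (hf h) ih

theorem RotationChain.node {j k : ℕ} {l l' r r' : BinaryTree Unit} (h : RotationChain j l l')
    (h' : RotationChain k r r') : RotationChain (j + k) (.node () l r) (.node () l' r') :=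
  (h.map (f := fun l => .node () l r) fun h => .left r h).trans
    (h'.map (f := fun r => .node () l' r) fun h => .right l' h)

theorem TreeRotation.stack_right {u u' : BinaryTree Unit} (v : BinaryTree Unit)
    (h : TreeRotation u u') : TreeRotation (stack u v) (stack u' v) := by
  induction v with
  | nil => exact h
  | node _ l r hl _ => exact .left r hl

/-- Each rotation makes the next sibling of the root of `A` its new last child, so one rotation is
spent on each tree of `B`. -/
theorem rotationChain_stack (L A B : BinaryTree Unit) :
    RotationChain (leftBranchLength B) (stack L (stack (.node () .nil A) B))
      (.node () L (stack A B)) := by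
  rw [← stack_assoc, ← node_eq_stack]
  induction B with
  | nil => exact .refl _
  | node _ l r hl _ =>
    exact (hl.map (f := fun l => .node () l r) fun h => .left r h).trans (.single (.rotate _ _ _))

/-- Undoing a rotation turns the last child of some node into the next sibling of that node. This
happens inside one tree of the forest, so it affects only one part of a concatenation. -/
theorem TreeRotation.of_stack {X U V : BinaryTree Unit} (h : TreeRotation X (stack U V)) :
    (∃ U', X = stack U' V ∧ TreeRotation U' U) ∨ ∃ V', X = stack U V' ∧ TreeRotation V' V := by
  induction V generalizing X with
  | nil => exact .inl ⟨X, rfl, h⟩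
  | node _ l r hl _ =>
    cases h with
    | rotate a b c => exact .inr ⟨.node () (.node () l b) c, rfl, .rotate _ _ _⟩
    | left _ h =>
      obtain ⟨U', rfl, h'⟩ | ⟨V', rfl, h'⟩ := hl h
      · exact .inl ⟨U', rfl, h'⟩
      · exact .inr ⟨.node () V' r, rfl, .left _ h'⟩
    | right _ h => exact .inr ⟨_, rfl, .right _ h⟩

theorem TreeRotation.leftBranchLength_le {s t : BinaryTree Unit} (h : TreeRotation s t) :
    leftBranchLength t ≤ leftBranchLength s := by
  induction h <;> simp_all [leftBranchLength]

/-! ### Grafting trees and the Tamari order -/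

/-- The sum over all nodes of the difference between the largest possible label and the label. -/
def labelDefect : BinaryTree ℕ → ℕ
  | .nil => 0
  | .node x l r => labelDefect l + labelDefect r + (r.numNodes - labelSum r - x)

theorem labelDefect_node {l r : BinaryTree ℕ} (hr : IsGraftingTree r) {A B : BinaryTree Unit}
    (h : lowerTree r = stack A B) :
    labelDefect (.node (leftBranchLength A) l r) =
      labelDefect l + labelDefect r + leftBranchLength B := by
  have := leftBranchLength_lowerTree hr
  rw [h, leftBranchLength_stack] at this
  simp only [labelDefect]
  omega

/-- Give every node its largest possible label. -/
theorem exists_lowerTree_eq_shape (T : BinaryTree Unit) :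
    ∃ G, IsGraftingTree G ∧ shape G = T ∧ lowerTree G = T := by
  induction T with
  | nil => exact ⟨.nil, trivial, rfl, rfl⟩
  | node _ l r hl hr =>
    obtain ⟨G, hG, rfl, hG'⟩ := hl
    obtain ⟨H, hH, rfl, hH'⟩ := hr
    have := lowerTree_node hG hH (A := lowerTree H) (B := .nil) rfl
    refine ⟨_, this.1, rfl, ?_⟩
    rw [this.2, hG', hH']
    rfl

/-- The undone rotation either cuts the last child off the root of `G`, which lowers the label of
the root by one, or takes place in the lower forest of `l` or of `r`, where induction applies. -/
theorem exists_graftingTree_of_treeRotation {G : BinaryTree ℕ} (hG : IsGraftingTree G)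
    {S : BinaryTree Unit} (h : TreeRotation S (lowerTree G)) :
    ∃ G', IsGraftingTree G' ∧ shape G' = shape G ∧ lowerTree G' = S ∧
      labelDefect G < labelDefect G' := by
  induction G generalizing S with
  | nil => cases h
  | node x l r hl hr =>
    have hl' := hG.2.1
    have hr' := hG.2.2
    obtain ⟨A, B, h1, rfl, h3⟩ := exists_lowerTree_node hG
    have hd := labelDefect_node (l := l) hr' h1
    rw [h3] at h
    obtain ⟨L, rfl, hL⟩ | ⟨V, rfl, hV⟩ := h.of_stack
    · obtain ⟨l', k1, k2, k3, k4⟩ := hl hl' hL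
      have := lowerTree_node k1 hr' h1
      refine ⟨_, this.1, by simp [k2], by rw [this.2, k3], ?_⟩
      rw [hd, labelDefect_node hr' h1]
      omega
    obtain ⟨C, rfl, hC⟩ | ⟨B', rfl, hB'⟩ := hV.of_stack
    · cases hC with
      -- Here `A` is `b` followed by one last tree. This tree leaves the root and joins `B`, so the
      -- slack of the root grows by one.
      | rotate _ b c =>
        have h1' : lowerTree r = stack b (stack (.node () .nil c) B) := by
          rw [h1, ← stack_assoc, node_eq_stack]
        have := lowerTree_node hl' hr' h1'
        refine ⟨_, this.1, by simp, ?_, ?_⟩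
        · rw [this.2, ← stack_assoc (.node () .nil b), ← node_eq_stack]
        · rw [hd, labelDefect_node hr' h1']
          simp [leftBranchLength]
      | left _ hn => cases hn
      | @right _ A' _ h =>
        obtain ⟨r', k1, k2, k3, k4⟩ := hr hr' (h1 ▸ h.stack_right B)
        have := lowerTree_node hl' k1 k3
        refine ⟨_, this.1, by simp [k2], this.2, ?_⟩
        rw [hd, labelDefect_node k1 k3]
        omega
    · have hB : TreeRotation (stack A B') (stack A B) := by
        clear * - hB'
        induction hB' with
        | rotate a b c => exact .rotate _ _ _
        | left r h ih => exact .left _ ih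
        | right l h _ => exact .right _ h
      obtain ⟨r', k1, k2, k3, k4⟩ := hr hr' (h1 ▸ hB)
      have := lowerTree_node hl' k1 k3
      refine ⟨_, this.1, by simp [k2], this.2, ?_⟩
      rw [hd, labelDefect_node k1 k3]
      -- The slack of the root is the number of trees of `B'`, which is at least that of `B`.
      have := hB'.leftBranchLength_le
      omega

theorem RotationChain.exists_graftingTree {k : ℕ} {S T : BinaryTree Unit}
    (h : RotationChain k S T) :
    ∃ G, IsGraftingTree G ∧ shape G = T ∧ lowerTree G = S ∧ k ≤ labelDefect G := by
  induction h with
  | refl t =>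
    obtain ⟨G, h1, h2, h3⟩ := exists_lowerTree_eq_shape t
    exact ⟨G, h1, h2, h3, Nat.zero_le _⟩
  | head h _ ih =>
    obtain ⟨G, h1, rfl, rfl, h4⟩ := ih
    obtain ⟨G', k1, k2, k3, k4⟩ := exists_graftingTree_of_treeRotation h1 h
    exact ⟨G', k1, k2, k3, by omega⟩

/-- The root first takes all the trees that it can still take, one rotation per unit of slack; then
the two subtrees are independent. -/
theorem rotationChain_labelDefect {G : BinaryTree ℕ} (hG : IsGraftingTree G) :
    RotationChain (labelDefect G) (lowerTree G) (shape G) := by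
  induction G with
  | nil => exact .refl _
  | node x l r hl hr =>
    obtain ⟨A, B, h1, rfl, h3⟩ := exists_lowerTree_node hG
    rw [h3, labelDefect_node hG.2.2 h1, Nat.add_comm]
    refine (rotationChain_stack _ A B).trans ?_
    rw [← h1]
    exact (hl hG.2.1).node (hr hG.2.2)

/-- The intervals of the Tamari order on binary trees. -/
def IsTreeInterval (I : BinaryTree Unit × BinaryTree Unit) : Prop :=
  ∃ k, RotationChain k I.1 I.2

theorem IsTreeInterval.isGraftingTree {I : BinaryTree Unit × BinaryTree Unit}
    (h : IsTreeInterval I) : IsGraftingTree (graft I) := by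
  obtain ⟨k, h⟩ := h
  obtain ⟨G, h1, h2, h3, -⟩ := h.exists_graftingTree
  have : I = ungraft G := Prod.ext h3.symm h2.symm
  rwa [this, graft_ungraft h1]

theorem isTreeInterval_ungraft {G : BinaryTree ℕ} (hG : IsGraftingTree G) :
    IsTreeInterval (ungraft G) := ⟨_, rotationChain_labelDefect hG⟩

theorem IsTreeInterval.numNodes_eq {I : BinaryTree Unit × BinaryTree Unit}
    (h : IsTreeInterval I) : I.1.numNodes = I.2.numNodes := h.elim fun _ h => h.numNodes_eq

theorem IsTreeInterval.ungraft_graft {I : BinaryTree Unit × BinaryTree Unit}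
    (h : IsTreeInterval I) : ungraft (graft I) = I := MTamari.ungraft_graft h.numNodes_eq

/-- The distance of an interval of binary trees is read on its grafting tree. -/
theorem isGreatest_labelDefect {I : BinaryTree Unit × BinaryTree Unit} (h : IsTreeInterval I) :
    IsGreatest {k | RotationChain k I.1 I.2} (labelDefect (graft I)) := by
  constructor
  · have := rotationChain_labelDefect h.isGraftingTree
    have hI := h.ungraft_graft
    change RotationChain _ (ungraft (graft I)).1 (ungraft (graft I)).2 at this
    rwa [hI] at this
  · intro k hk
    obtain ⟨G, h1, h2, h3, h4⟩ := RotationChain.exists_graftingTree hk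
    have : I = ungraft G := Prod.ext h3.symm h2.symm
    rwa [this, graft_ungraft h1]

/-! ### The mirror image -/

@[simp] theorem mirror_mirror (t : BinaryTree Unit) : mirror (mirror t) = t := by
  induction t with
  | nil => rfl
  | node _ l r hl hr => simp [mirror, hl, hr]

@[simp] theorem numNodes_mirror (t : BinaryTree Unit) : (mirror t).numNodes = t.numNodes := by
  induction t with
  | nil => rfl
  | node _ l r hl hr => simp [mirror, hl, hr]; omega

theorem TreeRotation.mirror {s t : BinaryTree Unit} (h : TreeRotation s t) :
    TreeRotation (mirror t) (mirror s) := by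
  induction h with
  | rotate a b c => exact .rotate _ _ _
  | left r _ ih => exact .right _ ih
  | right l _ ih => exact .left _ ih

theorem RotationChain.mirror {k : ℕ} {s t : BinaryTree Unit} (h : RotationChain k s t) :
    RotationChain k (mirror t) (mirror s) := by
  induction h with
  | refl => exact .refl _
  | head h _ ih => exact ih.trans (.single h.mirror)

theorem complement_complement (I : BinaryTree Unit × BinaryTree Unit) :
    complement (complement I) = I := by
  simp [complement]

theorem IsTreeInterval.complement {I : BinaryTree Unit × BinaryTree Unit}
    (h : IsTreeInterval I) : IsTreeInterval (complement I) :=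
  h.imp fun _ h => h.mirror

/-- The labels of the complement are not compared with those of `I`: the slack is the length of a
longest chain, and mirroring reverses chains. -/
theorem labelDefect_graft_complement {I : BinaryTree Unit × BinaryTree Unit}
    (h : IsTreeInterval I) :
    labelDefect (graft (complement I)) = labelDefect (graft I) := by
  have hI : {k | RotationChain k (complement I).1 (complement I).2} =
      {k | RotationChain k I.1 I.2} := by
    ext k
    refine ⟨fun hk => ?_, fun hk => RotationChain.mirror hk⟩
    simpa [MTamari.complement] using RotationChain.mirror hk
  exact (hI ▸ isGreatest_labelDefect h.complement).unique (isGreatest_labelDefect h)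

/-! ### The left-branch involution -/

/-- Accumulator form of the fact that reversing twice is the identity, which is the case of empty
`a` and `b`. -/
theorem reverseLeftBranchesAux_reverseLeftBranchesAux (t a b : BinaryTree ℕ) :
    reverseLeftBranchesAux (reverseLeftBranchesAux t a) b =
      reverseLeftBranchesAux a (stack b t) := by
  induction t generalizing a b with
  | nil => rfl
  | node x l r hl hr =>
    simp only [reverseLeftBranchesAux, hl, hr, stack, nil_stack]

theorem reverseLeftBranches_reverseLeftBranches (G : BinaryTree ℕ) :
    reverseLeftBranches (reverseLeftBranches G) = G := by
  simp [reverseLeftBranches, reverseLeftBranchesAux_reverseLeftBranchesAux,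
    reverseLeftBranchesAux]

theorem numNodes_reverseLeftBranchesAux (G H : BinaryTree ℕ) :
    (reverseLeftBranchesAux G H).numNodes = G.numNodes + H.numNodes := by
  induction G generalizing H with
  | nil => simp [reverseLeftBranchesAux]
  | node x l r hl hr => simp [reverseLeftBranchesAux, hl, hr]; omega

theorem labelSum_reverseLeftBranchesAux (G H : BinaryTree ℕ) :
    labelSum (reverseLeftBranchesAux G H) = labelSum G + labelSum H := by
  induction G generalizing H with
  | nil => simp [reverseLeftBranchesAux, labelSum]
  | node x l r hl hr => simp [reverseLeftBranchesAux, hl, hr, labelSum]; omega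

theorem labels_reverseLeftBranchesAux (G H : BinaryTree ℕ) :
    (labels (reverseLeftBranchesAux G H) : Multiset ℕ) = labels G + labels H := by
  induction G generalizing H with
  | nil => simp [reverseLeftBranchesAux, labels]
  | node x l r hl hr =>
    simp only [reverseLeftBranchesAux, hl, labels, ← Multiset.coe_add, ← Multiset.cons_coe, hr,
      Multiset.coe_nil, add_zero, Multiset.add_cons, Multiset.cons_add]
    congr 1
    abel

theorem isGraftingTree_reverseLeftBranchesAux {G H : BinaryTree ℕ} (hG : IsGraftingTree G)
    (hH : IsGraftingTree H) : IsGraftingTree (reverseLeftBranchesAux G H) := by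
  induction G generalizing H with
  | nil => exact hH
  | node x l r hl hr =>
    refine hl hG.2.1 ⟨?_, hH, hr hG.2.2 trivial⟩
    have := hG.1
    simpa [numNodes_reverseLeftBranchesAux, labelSum_reverseLeftBranchesAux, labelSum] using this

theorem labelDefect_reverseLeftBranchesAux (G H : BinaryTree ℕ) :
    labelDefect (reverseLeftBranchesAux G H) = labelDefect G + labelDefect H := by
  induction G generalizing H with
  | nil => simp [reverseLeftBranchesAux, labelDefect]
  | node x l r hl hr =>
    simp [reverseLeftBranchesAux, hl, hr, labelDefect, numNodes_reverseLeftBranchesAux,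
      labelSum_reverseLeftBranchesAux, labelSum]
    omega

theorem IsGraftingTree.reverseLeftBranches {G : BinaryTree ℕ} (hG : IsGraftingTree G) :
    IsGraftingTree (reverseLeftBranches G) :=
  isGraftingTree_reverseLeftBranchesAux hG trivial

theorem labelSum_reverseLeftBranches (G : BinaryTree ℕ) :
    labelSum (reverseLeftBranches G) = labelSum G :=
  labelSum_reverseLeftBranchesAux G .nil

theorem numNodes_reverseLeftBranches (G : BinaryTree ℕ) :
    (reverseLeftBranches G).numNodes = G.numNodes :=
  numNodes_reverseLeftBranchesAux G .nil

theorem labels_reverseLeftBranches (G : BinaryTree ℕ) :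
    (labels (reverseLeftBranches G) : Multiset ℕ) = labels G := by
  rw [reverseLeftBranches, labels_reverseLeftBranchesAux]
  simp [labels]

theorem labelDefect_reverseLeftBranches (G : BinaryTree ℕ) :
    labelDefect (reverseLeftBranches G) = labelDefect G :=
  labelDefect_reverseLeftBranchesAux G .nil

theorem IsTreeInterval.graft_leftBranchInvolution {I : BinaryTree Unit × BinaryTree Unit}
    (h : IsTreeInterval I) :
    graft (leftBranchInvolution I) = reverseLeftBranches (graft I) :=
  graft_ungraft h.isGraftingTree.reverseLeftBranches

theorem IsTreeInterval.leftBranchInvolution {I : BinaryTree Unit × BinaryTree Unit}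
    (h : IsTreeInterval I) : IsTreeInterval (leftBranchInvolution I) :=
  isTreeInterval_ungraft h.isGraftingTree.reverseLeftBranches

theorem IsTreeInterval.leftBranchInvolution_leftBranchInvolution
    {I : BinaryTree Unit × BinaryTree Unit} (h : IsTreeInterval I) :
    MTamari.leftBranchInvolution (MTamari.leftBranchInvolution I) = I := by
  rw [MTamari.leftBranchInvolution, h.graft_leftBranchInvolution,
    reverseLeftBranches_reverseLeftBranches, h.ungraft_graft]

theorem IsTreeInterval.riseContact {I : BinaryTree Unit × BinaryTree Unit}
    (h : IsTreeInterval I) : IsTreeInterval (riseContact I) :=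
  h.leftBranchInvolution.complement.leftBranchInvolution

theorem IsTreeInterval.riseContact_riseContact {I : BinaryTree Unit × BinaryTree Unit}
    (h : IsTreeInterval I) : MTamari.riseContact (MTamari.riseContact I) = I := by
  rw [MTamari.riseContact, MTamari.riseContact,
    h.leftBranchInvolution.complement.leftBranchInvolution_leftBranchInvolution,
    complement_complement, h.leftBranchInvolution_leftBranchInvolution]

theorem IsTreeInterval.labelDefect_riseContact {I : BinaryTree Unit × BinaryTree Unit}
    (h : IsTreeInterval I) :
    labelDefect (graft (MTamari.riseContact I)) = labelDefect (graft I) := by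
  rw [MTamari.riseContact, h.leftBranchInvolution.complement.graft_leftBranchInvolution,
    labelDefect_reverseLeftBranches, labelDefect_graft_complement h.leftBranchInvolution,
    h.graft_leftBranchInvolution, labelDefect_reverseLeftBranches]

/-! ### Dyck paths of binary trees -/

theorem count_treeToDyck (t : BinaryTree Unit) (b : Bool) :
    (treeToDyck t).count b = t.numNodes := by
  induction t with
  | nil => rfl
  | node _ l r hl hr => cases b <;> simp [treeToDyck, hl, hr] <;> omega

theorem prefix_append_cases {α : Type*} {u a b : List α} (h : u <+: a ++ b) :
    u <+: a ∨ ∃ v, u = a ++ v ∧ v <+: b := by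
  obtain ⟨x, hx⟩ := h
  rcases List.append_eq_append_iff.1 hx with ⟨y, rfl, rfl⟩ | ⟨y, rfl, rfl⟩
  · exact .inl ⟨y, rfl⟩
  · exact .inr ⟨y, rfl, _, rfl⟩

theorem count_false_le_of_prefix_treeToDyck (t : BinaryTree Unit) {u : Path}
    (hu : u <+: treeToDyck t) : u.count false ≤ u.count true := by
  induction t generalizing u with
  | nil =>
    obtain rfl := List.prefix_nil.1 hu
    rfl
  | node _ l r hl hr =>
    obtain hu | ⟨v, rfl, hv⟩ := prefix_append_cases hu
    · exact hl hu
    rcases List.prefix_cons_iff.1 hv with rfl | ⟨v, rfl, hv'⟩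
    · simpa using hl (List.prefix_refl _)
    rcases List.prefix_concat_iff.1 hv' with rfl | hv
    · simp [count_treeToDyck]
    · have := hr hv
      simp [count_treeToDyck]; omega

theorem isBallotPath_treeToDyck (t : BinaryTree Unit) :
    IsBallotPath 1 t.numNodes (treeToDyck t) :=
  ⟨count_treeToDyck t _, by simp [count_treeToDyck], fun u hu => by
    simpa using count_false_le_of_prefix_treeToDyck t hu⟩

theorem count_true_le_of_suffix_treeToDyck {t : BinaryTree Unit} {u v : Path}
    (h : treeToDyck t = u ++ v) : v.count true ≤ v.count false := by
  have h1 := count_false_le_of_prefix_treeToDyck t (u := u) (h ▸ List.prefix_append _ _)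
  have h2 := count_treeToDyck t true
  have h3 := count_treeToDyck t false
  rw [h, List.count_append] at h2 h3
  omega

theorem dyckToTreeAux_treeToDyck (t : BinaryTree Unit) (s : List (BinaryTree Unit)) (w : Path) :
    dyckToTreeAux (.nil :: s) (treeToDyck t ++ w) = dyckToTreeAux (t :: s) w := by
  induction t generalizing s w with
  | nil => rfl
  | node _ l r hl hr => simp [treeToDyck, hl, hr, dyckToTreeAux]

@[simp] theorem dyckToTree_treeToDyck (t : BinaryTree Unit) : dyckToTree (treeToDyck t) = t := by
  have := dyckToTreeAux_treeToDyck t [] []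
  rw [List.append_nil] at this
  rw [dyckToTree, this, dyckToTreeAux]

/-- The path that has been read when `dyckToTreeAux` has the given stack. -/
def stackPath : List (BinaryTree Unit) → Path
  | [] => []
  | [t] => treeToDyck t
  | t :: s => stackPath s ++ true :: treeToDyck t

/-- The length of `s` is the current height: the hypotheses say that `w` descends from this height
to zero without going below zero. -/
theorem treeToDyck_dyckToTreeAux (w : Path) (t : BinaryTree Unit) (s : List (BinaryTree Unit))
    (h : s.length + w.count true = w.count false)
    (h' : ∀ u : Path, u <+: w → u.count false ≤ s.length + u.count true) :
    treeToDyck (dyckToTreeAux (t :: s) w) = stackPath (t :: s) ++ w := by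
  induction w generalizing t s with
  | nil =>
    obtain rfl : s = [] := by simpa using h
    simp [dyckToTreeAux, stackPath]
  | cons b w ih =>
    cases b with
    | true =>
      rw [dyckToTreeAux, ih]
      · simp [stackPath, treeToDyck]
      · simp at h ⊢; omega
      · intro u hu
        have := h' (true :: u) ((List.prefix_cons_inj _).2 hu)
        simp at this ⊢; omega
    | false =>
      cases s with
      | nil => simpa using h' [false] (by simp)
      | cons l s =>
        rw [dyckToTreeAux, ih]
        · cases s <;> simp [stackPath, treeToDyck]
        · simp at h ⊢; omega
        · intro u hu
          have := h' (false :: u) ((List.prefix_cons_inj _).2 hu)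
          simp at this ⊢; omega

theorem treeToDyck_dyckToTree {n : ℕ} {w : Path} (h : IsBallotPath 1 n w) :
    treeToDyck (dyckToTree w) = w := by
  obtain ⟨h1, h2, h3⟩ := h
  rw [dyckToTree, treeToDyck_dyckToTreeAux]
  · rfl
  · simp; omega
  · simpa using h3

theorem isExcursion_node (r : BinaryTree Unit) :
    IsExcursion 1 (true :: (treeToDyck r ++ [false])) := by
  refine ⟨by simp, by simp [count_treeToDyck], fun u hu h1 h2 => ?_⟩
  rcases List.prefix_cons_iff.1 hu with rfl | ⟨v, rfl, hv⟩
  · exact absurd rfl h1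
  rcases List.prefix_concat_iff.1 hv with rfl | hv
  · exact absurd rfl h2
  · have := count_false_le_of_prefix_treeToDyck r hv
    simp; omega

/-- An excursion stops at the first return to its line, so the word that it begins determines it. -/
theorem IsExcursion.eq_of_append_eq_append {m : ℕ} {b b' c c' : Path} (h : IsExcursion m b)
    (h' : IsExcursion m b') (e : b ++ c = b' ++ c') : b = b' := by
  by_contra hne
  rcases List.append_eq_append_iff.1 e with ⟨y, rfl, rfl⟩ | ⟨y, rfl, rfl⟩
  · have := h'.2.2 b (List.prefix_append _ _) h.1 hne
    have := h.2.1
    omega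
  · have := h.2.2 b' (List.prefix_append _ _) h'.1 (Ne.symm hne)
    have := h'.2.1
    omega

theorem IsExcursion.eq_true_cons {m : ℕ} {b : Path} (h : IsExcursion m b) :
    ∃ b', b = true :: b' := by
  obtain ⟨h1, h2, h3⟩ := h
  match b with
  | [] => exact absurd rfl h1
  | true :: b' => exact ⟨b', rfl⟩
  | false :: b' =>
    by_cases hb : b' = []
    · subst hb; simp at h2
    · simpa using h3 [false] (by simp) (by simp) (by simpa using Ne.symm hb)

theorem IsExcursion.eq_append_false {m : ℕ} (hm : 1 ≤ m) {b : Path} (h : IsExcursion m b) :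
    ∃ b', b = b' ++ [false] := by
  obtain ⟨h1, h2, h3⟩ := h
  induction b using List.reverseRecOn with
  | nil => exact absurd rfl h1
  | append_singleton b x _ =>
    cases x with
    | false => exact ⟨b, rfl⟩
    | true =>
      by_cases hb : b = []
      · subst hb
        simp at h2
        omega
      · have := h3 b (by simp) hb (by simp)
        simp [Nat.mul_add] at h2
        omega

/-! ### Rotations of trees and rotations of Dyck paths -/

theorem TreeRotation.rotation {s t : BinaryTree Unit} (h : TreeRotation s t) :
    Rotation 1 (treeToDyck s) (treeToDyck t) := by
  induction h with
  | rotate a b c =>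
    exact ⟨treeToDyck a ++ true :: treeToDyck b, _, [], isExcursion_node c,
      by simp [treeToDyck], by simp [treeToDyck]⟩
  | left r _ ih =>
    obtain ⟨a, b, c, hb, h1, h2⟩ := ih
    exact ⟨a, b, c ++ true :: (treeToDyck r ++ [false]), hb, by simp [treeToDyck, h1],
      by simp [treeToDyck, h2]⟩
  | right l _ ih =>
    obtain ⟨a, b, c, hb, h1, h2⟩ := ih
    exact ⟨treeToDyck l ++ true :: a, b, c ++ [false], hb, by simp [treeToDyck, h1],
      by simp [treeToDyck, h2]⟩

/-- The rotated portion lies inside D(l) or inside D(r), or else the down step ends D(l) and the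
excursion is all of 1 D(r) 0, a rotation at the root. Positions astride these boundaries are
excluded by counting steps. -/
theorem exists_treeRotation {s : BinaryTree Unit} {a b c : Path} (hb : IsExcursion 1 b)
    (h : treeToDyck s = a ++ false :: (b ++ c)) :
    ∃ t, treeToDyck t = a ++ (b ++ false :: c) ∧ TreeRotation s t := by
  have hb0 := hb.1
  induction s generalizing a c with
  | nil => simp [treeToDyck] at h
  | node _ l r hl hr =>
    rw [treeToDyck] at h
    have left_case : ∀ c', treeToDyck l = a ++ false :: (b ++ c') →
        c = c' ++ true :: (treeToDyck r ++ [false]) →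
        ∃ t, treeToDyck t = a ++ (b ++ false :: c) ∧ TreeRotation (.node () l r) t := by
      rintro c' h' rfl
      obtain ⟨t, ht, hlt⟩ := hl h'
      exact ⟨.node () t r, by simp [treeToDyck, ht], .left _ hlt⟩
    rcases List.append_eq_append_iff.1 h with ⟨y, rfl, hy⟩ | ⟨y, hy, hy'⟩
    · rcases y with _ | ⟨_, y⟩
      · simp at hy
      simp only [List.cons_append, List.cons.injEq] at hy
      obtain ⟨rfl, hy⟩ := hy
      rcases List.append_eq_append_iff.1 hy with ⟨z, rfl, hz⟩ | ⟨z, hz, hz'⟩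
      · rcases z with _ | ⟨_, z⟩ <;> simp at hz
        exact absurd hz.1 hb0
      · rcases z with _ | ⟨_, z⟩
        · simp at hz'
          exact absurd hz'.1 hb0
        simp only [List.cons_append, List.cons.injEq] at hz'
        obtain ⟨rfl, hz'⟩ := hz'
        rcases List.append_eq_append_iff.1 hz' with ⟨c', rfl, rfl⟩ | ⟨c', rfl, hc'⟩
        · obtain ⟨t, ht, hrt⟩ := hr hz
          exact ⟨.node () l t, by simp [treeToDyck, ht], .right _ hrt⟩
        · rcases c' with _ | ⟨x, c'⟩
          · simp only [List.nil_append] at hc'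
            subst hc'
            rw [List.append_nil] at hb
            obtain ⟨t, ht, hrt⟩ := hr (c := []) (by simpa using hz)
            exact ⟨.node () l t, by simp [treeToDyck, ht], .right _ hrt⟩
          · simp only [List.cons_append, List.cons.injEq, List.nil_eq,
              List.append_eq_nil_iff] at hc'
            obtain ⟨rfl, rfl, rfl⟩ := hc'
            -- Here `b` would be a suffix of D(r) followed by the final down step. Such a suffix has
            -- at least as many down as up steps, so `b` would not be balanced.
            have h1 := hb.2.1
            have h2 := count_true_le_of_suffix_treeToDyck (v := z) (u := y ++ [false])
              (by simpa using hz)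
            simp at h1
            omega
    · rcases y with _ | ⟨_, y⟩
      · simp at hy'
      simp only [List.cons_append, List.cons.injEq] at hy'
      obtain ⟨rfl, hy'⟩ := hy'
      rcases List.append_eq_append_iff.1 hy' with ⟨c', rfl, rfl⟩ | ⟨c', rfl, hc'⟩
      · exact left_case c' hy rfl
      · by_cases hc0 : c' = []
        · subst hc0
          exact left_case [] (by simpa using hy) hc'.symm
        by_cases hy0 : y = []
        · subst hy0
          have he := (isExcursion_node r).eq_of_append_eq_append (c := []) (c' := c) hb
            (by simpa using hc')
          simp only [List.nil_append] at he
          subst he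
          obtain rfl : c = [] := by simpa using hc'
          cases l with
          | nil => simp [treeToDyck] at hy
          | node _ l1 l2 =>
            obtain rfl : treeToDyck l1 ++ true :: treeToDyck l2 = a := by
              apply List.append_cancel_right (bs := [false])
              simpa [treeToDyck] using hy
            exact ⟨.node () l1 (.node () l2 r), by simp [treeToDyck], .rotate _ _ _⟩
        -- As a proper prefix of an excursion, `y` has more up than down steps; as a suffix of D(l),
        -- it does not.
        · have h1 := hb.2.2 y (List.prefix_append _ _) hy0 (by simpa using hc0)
          have h2 := count_true_le_of_suffix_treeToDyck (v := y) (u := a ++ [false])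
            (by simpa using hy)
          omega

/-! ### Dyck paths of ballot paths -/

@[simp] theorem ballotToDyck_nil (m : ℕ) : ballotToDyck m [] = [] := rfl

@[simp] theorem ballotToDyck_true (m : ℕ) (w : Path) :
    ballotToDyck m (true :: w) = List.replicate m true ++ ballotToDyck m w := rfl

@[simp] theorem ballotToDyck_false (m : ℕ) (w : Path) :
    ballotToDyck m (false :: w) = false :: ballotToDyck m w := rfl

@[simp] theorem ballotToDyck_append (m : ℕ) (u w : Path) :
    ballotToDyck m (u ++ w) = ballotToDyck m u ++ ballotToDyck m w := by
  simp [ballotToDyck]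

@[simp] theorem count_false_ballotToDyck (m : ℕ) (w : Path) :
    (ballotToDyck m w).count false = w.count false := by
  induction w with
  | nil => rfl
  | cons b w ih => cases b <;> simp [ih, List.count_replicate]

@[simp] theorem count_true_ballotToDyck (m : ℕ) (w : Path) :
    (ballotToDyck m w).count true = m * w.count true := by
  induction w with
  | nil => rfl
  | cons b w ih => cases b <;> simp [ih, Nat.mul_add, Nat.add_comm]

theorem ballotToDyck_eq_nil {m : ℕ} (hm : 1 ≤ m) {w : Path} : ballotToDyck m w = [] ↔ w = [] := by
  cases w with
  | nil => simp
  | cons b w => cases b <;> simp; omega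

theorem exists_of_prefix_ballotToDyck {m : ℕ} {u w : Path} (h : u <+: ballotToDyck m w) :
    ∃ v j, v <+: w ∧ u = ballotToDyck m v ++ List.replicate j true := by
  induction w generalizing u with
  | nil => exact ⟨[], 0, List.prefix_refl _, by simpa using h⟩
  | cons b w ih =>
    cases b with
    | false =>
      rcases List.prefix_cons_iff.1 h with rfl | ⟨u, rfl, hu⟩
      · exact ⟨[], 0, by simp, rfl⟩
      · obtain ⟨v, j, hv, rfl⟩ := ih hu
        exact ⟨false :: v, j, (List.prefix_cons_inj _).2 hv, rfl⟩
    | true =>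
      rcases prefix_append_cases h with hu | ⟨u, rfl, hu⟩
      · refine ⟨[], u.length, by simp, ?_⟩
        rw [ballotToDyck_nil, List.nil_append]
        exact List.eq_replicate_of_mem fun b hb => List.eq_of_mem_replicate (hu.subset hb)
      · obtain ⟨v, j, hv, rfl⟩ := ih hu
        exact ⟨true :: v, j, (List.prefix_cons_inj _).2 hv, by simp⟩

theorem IsBallotPath.ballotToDyck {m n : ℕ} {w : Path} (h : IsBallotPath m n w) :
    IsBallotPath 1 (n * m) (ballotToDyck m w) := by
  obtain ⟨h1, h2, h3⟩ := h
  refine ⟨by simp [h1, Nat.mul_comm], by simp [h2, Nat.mul_comm], fun u hu => ?_⟩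
  obtain ⟨v, j, hv, rfl⟩ := exists_of_prefix_ballotToDyck hu
  have := h3 v hv
  simp [List.count_replicate]
  omega

theorem prefix_ballotToDyck {m : ℕ} {u w : Path} (h : u <+: w) :
    ballotToDyck m u <+: ballotToDyck m w := by
  obtain ⟨x, rfl⟩ := h
  simp

theorem IsBallotPath.of_ballotToDyck {m n : ℕ} (hm : 1 ≤ m) {w : Path}
    (h : IsBallotPath 1 (n * m) (MTamari.ballotToDyck m w)) : IsBallotPath m n w := by
  obtain ⟨h1, h2, h3⟩ := h
  refine ⟨?_, by simpa [Nat.mul_comm] using h2, fun u hu => ?_⟩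
  · rw [count_true_ballotToDyck, Nat.mul_comm] at h1
    exact Nat.eq_of_mul_eq_mul_right hm h1
  · simpa using h3 _ (prefix_ballotToDyck hu)

theorem IsExcursion.ballotToDyck {m : ℕ} (hm : 1 ≤ m) {b : Path} (h : IsExcursion m b) :
    IsExcursion 1 (ballotToDyck m b) := by
  obtain ⟨h1, h2, h3⟩ := h
  refine ⟨by simpa [ballotToDyck_eq_nil hm] using h1, by simp [h2], fun u hu hu1 hu2 => ?_⟩
  obtain ⟨v, j, hv, rfl⟩ := exists_of_prefix_ballotToDyck hu
  by_cases hv0 : v = []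
  · subst hv0
    have : j ≠ 0 := by rintro rfl; simp at hu1
    simp [List.count_replicate]; omega
  by_cases hvb : v = b
  · subst hvb
    have := hu.length_le
    obtain rfl : j = 0 := by simpa using this
    simp at hu2
  · have := h3 v hv hv0 hvb
    simp [List.count_replicate]; omega

theorem IsExcursion.of_ballotToDyck {m : ℕ} (hm : 1 ≤ m) {b : Path}
    (h : IsExcursion 1 (MTamari.ballotToDyck m b)) : IsExcursion m b := by
  obtain ⟨h1, h2, h3⟩ := h
  refine ⟨by simpa [ballotToDyck_eq_nil hm] using h1, by simpa using h2, fun u hu hu1 hu2 => ?_⟩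
  have := h3 _ (prefix_ballotToDyck hu) (by simpa [ballotToDyck_eq_nil hm] using hu1) ?_
  · simpa using this
  · intro h
    obtain ⟨x, rfl⟩ := hu
    rw [ballotToDyck_append, List.self_eq_append_right, ballotToDyck_eq_nil hm] at h
    simp [h] at hu2

theorem Rotation.ballotToDyck {m : ℕ} (hm : 1 ≤ m) {w w' : Path} (h : Rotation m w w') :
    Rotation 1 (ballotToDyck m w) (ballotToDyck m w') := by
  obtain ⟨a, b, c, hb, rfl, rfl⟩ := h
  exact ⟨_, _, MTamari.ballotToDyck m c, hb.ballotToDyck hm, by simp; rfl, by simp⟩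

theorem ballotToDyck_eq_append_false {m : ℕ} {w x y : Path}
    (h : ballotToDyck m w = x ++ false :: y) :
    ∃ x' y', w = x' ++ false :: y' ∧ ballotToDyck m x' = x ∧ ballotToDyck m y' = y := by
  induction w generalizing x with
  | nil => simp at h
  | cons b w ih =>
    cases b with
    | false =>
      rcases x with _ | ⟨b, x⟩
      · exact ⟨[], w, rfl, rfl, by simpa using h⟩
      · simp only [ballotToDyck_false, List.cons_append, List.cons.injEq] at h
        obtain ⟨rfl, h⟩ := h
        obtain ⟨x', y', rfl, rfl, rfl⟩ := ih h
        exact ⟨false :: x', y', rfl, rfl, rfl⟩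
    | true =>
      rw [ballotToDyck_true] at h
      rcases List.append_eq_append_iff.1 h with ⟨z, rfl, hz⟩ | ⟨z, hz, hz'⟩
      · obtain ⟨x', y', rfl, rfl, rfl⟩ := ih hz
        exact ⟨true :: x', y', rfl, rfl, rfl⟩
      · rcases z with _ | ⟨b, z⟩
        · obtain ⟨x', y', rfl, hx, rfl⟩ := ih (x := []) hz'.symm
          refine ⟨true :: x', y', rfl, ?_, rfl⟩
          rw [List.append_nil] at hz
          rw [ballotToDyck_true, hx, hz, List.append_nil]
        · simp only [List.cons_append, List.cons.injEq] at hz'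
          obtain ⟨rfl, -⟩ := hz'
          have : false ∈ List.replicate m true := by rw [hz]; simp
          simp at this

/-- A rotation cuts a Dyck path only next to down steps, since an excursion ends with one. It never
splits a block of `m` up steps, so the Dyck paths of ballot paths are closed under rotation. -/
theorem exists_rotation_of_ballotToDyck {m : ℕ} (hm : 1 ≤ m) {w v : Path}
    (h : Rotation 1 (ballotToDyck m w) v) :
    ∃ w', ballotToDyck m w' = v ∧ Rotation m w w' := by
  obtain ⟨a, b, c, hb, h1, rfl⟩ := h
  obtain ⟨a', y, rfl, rfl, h2⟩ := ballotToDyck_eq_append_false h1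
  obtain ⟨b, rfl⟩ := hb.eq_append_false le_rfl
  rw [List.append_assoc, List.singleton_append] at h2
  obtain ⟨b', c', rfl, rfl, rfl⟩ := ballotToDyck_eq_append_false h2
  exact ⟨a' ++ ((b' ++ [false]) ++ false :: c'), by simp, a', b' ++ [false], c',
    .of_ballotToDyck hm (by simpa using hb), by simp, rfl⟩

/-! ### Inverting the map to Dyck paths -/

theorem riseVectorAux_ballotToDyck (m k : ℕ) (w : Path) :
    riseVectorAux (m * k) (ballotToDyck m w) = (riseVectorAux k w).map (m * ·) := by
  have key : ∀ (i k : ℕ) (w : Path),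
      riseVectorAux k (List.replicate i true ++ w) = riseVectorAux (k + i) w := by
    intro i
    induction i with
    | zero => simp
    | succ i ih => intro k w; simp [List.replicate_succ, riseVectorAux, ih]; congr 1; omega
  induction w generalizing k with
  | nil => rfl
  | cons b w ih =>
    cases b with
    | true => rw [ballotToDyck_true, key, ← Nat.mul_succ, ih]; rfl
    | false => simpa [riseVectorAux] using ih 0

theorem riseVector_ballotToDyck (m : ℕ) (w : Path) :
    riseVector (ballotToDyck m w) = (riseVector w).map (m * ·) :=
  riseVectorAux_ballotToDyck m 0 w

theorem flatMap_riseVectorAux (k : ℕ) (u : Path) :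
    ((riseVectorAux k (u ++ [false])).flatMap fun r => List.replicate r true ++ [false]) =
      List.replicate k true ++ (u ++ [false]) := by
  induction u generalizing k with
  | nil => simp [riseVectorAux]
  | cons b u ih =>
    cases b with
    | true => simp [riseVectorAux, ih, List.replicate_succ']
    | false => simp [riseVectorAux, ih]

theorem flatMap_riseVector {u : Path} (hu : u = [] ∨ ∃ v, u = v ++ [false]) :
    ((riseVector u).flatMap fun r => List.replicate r true ++ [false]) = u := by
  rcases hu with rfl | ⟨v, rfl⟩
  · rfl
  · exact flatMap_riseVectorAux 0 v

theorem dyckToBallot_ballotToDyck {m : ℕ} (hm : 1 ≤ m) {w : Path}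
    (hw : w = [] ∨ ∃ v, w = v ++ [false]) : dyckToBallot m (ballotToDyck m w) = w := by
  rw [dyckToBallot, riseVector_ballotToDyck, List.flatMap_map]
  simp only [Nat.mul_div_cancel_left _ hm]
  exact flatMap_riseVector hw

theorem ballotToDyck_dyckToBallot {m : ℕ} {w : Path} (hw : w = [] ∨ ∃ v, w = v ++ [false])
    (h : ∀ r ∈ riseVector w, m ∣ r) : ballotToDyck m (dyckToBallot m w) = w := by
  have hrep : ∀ i, ballotToDyck m (List.replicate i true) = List.replicate (m * i) true := by
    intro i
    induction i with
    | zero => rfl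
    | succ i ih => simp [List.replicate_succ, ih, Nat.mul_succ, Nat.add_comm]
  conv_rhs => rw [← flatMap_riseVector hw]
  rw [dyckToBallot]
  generalize riseVector w = L at h
  induction L with
  | nil => rfl
  | cons r L ih =>
    have hr := Nat.mul_div_cancel' (h r (by simp))
    simp [hrep, hr, ih fun r hr => h r (by simp [hr])]

theorem treeToDyck_eq_nil_or (t : BinaryTree Unit) :
    treeToDyck t = [] ∨ ∃ v, treeToDyck t = v ++ [false] := by
  cases t with
  | nil => exact .inl rfl
  | node _ l r => exact .inr ⟨treeToDyck l ++ true :: treeToDyck r, by simp [treeToDyck]⟩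

theorem dyckToBallot_treeToDyck {m : ℕ} (hm : 1 ≤ m) {w : Path} {t : BinaryTree Unit}
    (h : treeToDyck t = ballotToDyck m w) : dyckToBallot m (treeToDyck t) = w := by
  rw [h]
  apply dyckToBallot_ballotToDyck hm
  rcases treeToDyck_eq_nil_or t with h' | ⟨v, h'⟩
  · left; rwa [h, ballotToDyck_eq_nil hm] at h'
  · right
    obtain ⟨x, y, rfl, -, h2⟩ := ballotToDyck_eq_append_false (h.symm.trans h')
    rw [ballotToDyck_eq_nil hm] at h2
    exact ⟨x, by rw [h2]⟩

/-! ### Expansion and contraction of labels -/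

/-- The `k`-th entry `x` of the list is positive unless `m` divides `j + k`, where `k = 1, 2, …`. -/
def PositiveOffMultiples (m : ℕ) : ℕ → List ℕ → Prop
  | _, [] => True
  | j, x :: L => (¬ m ∣ j + 1 → 1 ≤ x) ∧ PositiveOffMultiples m (j + 1) L

theorem positiveOffMultiples_append {m j : ℕ} {L L' : List ℕ} :
    PositiveOffMultiples m j (L ++ L') ↔
      PositiveOffMultiples m j L ∧ PositiveOffMultiples m (j + L.length) L' := by
  induction L generalizing j with
  | nil => simp [PositiveOffMultiples]
  | cons x L ih =>
    simp [PositiveOffMultiples, ih, and_assoc, Nat.add_assoc, Nat.add_comm 1]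

theorem positiveOffMultiples_iff {m j : ℕ} {L : List ℕ} :
    PositiveOffMultiples m j L ↔ ∀ k < L.length, ¬ m ∣ j + k + 1 → 1 ≤ L.getD k 0 := by
  induction L generalizing j with
  | nil => simp [PositiveOffMultiples]
  | cons x L ih =>
    simp only [PositiveOffMultiples, ih]
    constructor
    · rintro ⟨h1, h2⟩ (_ | k) hk hd
      · simpa using h1 hd
      · have := h2 k (by simpa using hk) (by rwa [show j + 1 + k + 1 = j + (k + 1) + 1 by omega])
        simpa using this
    · refine fun h => ⟨fun hd => by simpa using h 0 (by simp) hd, fun k hk hd => ?_⟩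
      have := h (k + 1) (by simpa using hk) (by rwa [show j + (k + 1) + 1 = j + 1 + k + 1 by omega])
      simpa using this

theorem mem_mGraftingTrees {m n : ℕ} {G : BinaryTree ℕ} :
    G ∈ mGraftingTrees m n ↔ IsGraftingTree G ∧ G.numNodes = n * m ∧
      PositiveOffMultiples m 0 (labels G) := by
  refine and_congr_right fun _ => and_congr_right fun h => ?_
  rw [positiveOffMultiples_iff, length_labels, h]
  constructor
  · intro H k hk hd
    simpa using H (k + 1) (by omega) hk (by simpa using hd)
  · intro H i h1 h2 hd
    exact H (i - 1) (by omega) (by rwa [show 0 + (i - 1) + 1 = i by omega])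

theorem positiveOffMultiples_node {m j x : ℕ} {l r : BinaryTree ℕ} :
    PositiveOffMultiples m j (labels (.node x l r)) ↔
      PositiveOffMultiples m j (labels l) ∧ (¬ m ∣ j + l.numNodes + 1 → 1 ≤ x) ∧
        PositiveOffMultiples m (j + l.numNodes + 1) (labels r) := by
  simp [labels, positiveOffMultiples_append, PositiveOffMultiples]

theorem positiveOffMultiples_childCounts_node {m j : ℕ} {l r : BinaryTree Unit} :
    PositiveOffMultiples m j (childCounts (.node () l r)) ↔
      PositiveOffMultiples m j (childCounts l) ∧ (¬ m ∣ j + l.numNodes + 1 → r ≠ .nil) ∧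
        PositiveOffMultiples m (j + l.numNodes + 1) (childCounts r) := by
  simp [childCounts, positiveOffMultiples_append, PositiveOffMultiples, leftBranchLength_pos]

/-- A positive label needs a nonempty right subtree, so the upper tree inherits the condition from
the lower one. -/
theorem PositiveOffMultiples.shape {m j : ℕ} {G : BinaryTree ℕ} (hG : IsGraftingTree G)
    (h : PositiveOffMultiples m j (labels G)) :
    PositiveOffMultiples m j (childCounts (shape G)) := by
  induction G generalizing j with
  | nil => trivial
  | node x l r hl hr =>
    rw [positiveOffMultiples_node] at h
    rw [shape_node, positiveOffMultiples_childCounts_node, numNodes_shape]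
    refine ⟨hl hG.2.1 h.1, fun hd => ?_, hr hG.2.2 h.2.2⟩
    have h1 := h.2.1 hd
    have h2 := hG.1
    rintro h3
    rw [shape_eq_nil] at h3
    subst h3
    simp at h2
    omega

/-- The last node of `t` in in-order has no right subtree, so its index, `j + t.numNodes`, must be a
multiple of `m`. -/
theorem PositiveOffMultiples.dvd {m j : ℕ} {t : BinaryTree Unit}
    (h : PositiveOffMultiples m j (childCounts t)) (ht : t ≠ .nil) : m ∣ j + t.numNodes := by
  induction t generalizing j with
  | nil => exact absurd rfl ht
  | node _ l r hl hr =>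
    rw [positiveOffMultiples_childCounts_node] at h
    by_cases hr0 : r = .nil
    · subst hr0
      by_contra hd
      exact h.2.1 (by simpa [Nat.add_assoc] using hd) rfl
    · have := hr h.2.2 hr0
      rw [BinaryTree.numNodes]
      convert this using 1
      omega

/-- Applies `f (j + k)` to the label of the node with in-order index `k`, where `k = 0, 1, …`. -/
def mapNodes (f : ℕ → ℕ → ℕ) : ℕ → BinaryTree ℕ → BinaryTree ℕ
  | _, .nil => .nil
  | j, .node x l r =>
      .node (f (j + l.numNodes) x) (mapNodes f j l) (mapNodes f (j + l.numNodes + 1) r)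

@[simp] theorem shape_mapNodes (f : ℕ → ℕ → ℕ) (j : ℕ) (G : BinaryTree ℕ) :
    shape (mapNodes f j G) = shape G := by
  induction G generalizing j with
  | nil => rfl
  | node x l r hl hr => simp [mapNodes, hl, hr]

@[simp] theorem numNodes_mapNodes (f : ℕ → ℕ → ℕ) (j : ℕ) (G : BinaryTree ℕ) :
    (mapNodes f j G).numNodes = G.numNodes := by
  rw [← numNodes_shape, shape_mapNodes, numNodes_shape]

theorem labels_mapNodes (f : ℕ → ℕ → ℕ) (j : ℕ) (G : BinaryTree ℕ) :
    labels (mapNodes f j G) = (labels G).mapIdx fun k => f (j + k) := by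
  induction G generalizing j with
  | nil => rfl
  | node x l r hl hr =>
    simp [mapNodes, labels, hl, hr, List.mapIdx_append, List.mapIdx_cons, Nat.add_assoc,
      Nat.add_comm, Nat.add_left_comm]

theorem relabel_shape_mapIdx (f : ℕ → ℕ → ℕ) (G : BinaryTree ℕ) :
    relabel (shape G) ((labels G).mapIdx f) = mapNodes f 0 G := by
  apply ext_of_shape_of_labels
  · simp
  · rw [labels_relabel _ _ (by simp), labels_mapNodes]
    simp

/-- The effect of `expand` on the label of the node with in-order index `k = 0, 1, …`. -/
def expandLabel (m k x : ℕ) : ℕ := if m ∣ k + 1 then m * x else m * (x - 1)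

/-- The effect of `contract` on the label of the node with in-order index `k = 0, 1, …`. -/
def contractLabel (m k x : ℕ) : ℕ := if m ∣ k + 1 then x / m else x / m + 1

theorem expand_eq_mapNodes (m : ℕ) (G : BinaryTree ℕ) :
    expand m G = mapNodes (expandLabel m) 0 G := relabel_shape_mapIdx _ _

theorem contract_eq_mapNodes (m : ℕ) (G : BinaryTree ℕ) :
    contract m G = mapNodes (contractLabel m) 0 G := relabel_shape_mapIdx _ _

theorem dvd_expandLabel (m k x : ℕ) : m ∣ expandLabel m k x := by
  unfold expandLabel; split <;> simp

/-- The two cases of `expandLabel` differ by `m` times the jump of the floor of `k / m`. In this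
form they telescope along the in-order. -/
theorem expandLabel_add {m k x : ℕ} (h : ¬ m ∣ k + 1 → 1 ≤ x) :
    expandLabel m k x + m + m * (k / m) = m * x + m * ((k + 1) / m) := by
  rw [Nat.succ_div, expandLabel]
  split
  · rw [Nat.mul_add]; omega
  · rename_i hd
    obtain ⟨y, rfl⟩ := Nat.exists_eq_add_of_le' (h hd)
    simp [Nat.mul_add]

theorem labelSum_mapNodes_expandLabel {m j : ℕ} {G : BinaryTree ℕ}
    (h : PositiveOffMultiples m j (labels G)) :
    labelSum (mapNodes (expandLabel m) j G) + m * G.numNodes + m * (j / m) =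
      m * labelSum G + m * ((j + G.numNodes) / m) := by
  induction G generalizing j with
  | nil => simp [mapNodes, labelSum]
  | node x l r hl hr =>
    rw [positiveOffMultiples_node] at h
    have h1 := hl h.1
    have h2 := hr h.2.2
    have h3 := expandLabel_add h.2.1
    simp only [mapNodes, labelSum, BinaryTree.numNodes, Nat.mul_add]
    rw [show j + (l.numNodes + r.numNodes + 1) = j + l.numNodes + 1 + r.numNodes by omega]
    omega

/-- The bound on the label of a node of an expanded tree, in terms of the original tree. -/
theorem expand_node_bound {m i x : ℕ} {r : BinaryTree ℕ} (hx : ¬ m ∣ i + 1 → 1 ≤ x)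
    (hr : PositiveOffMultiples m (i + 1) (labels r)) (hd : m ∣ i + 1 + r.numNodes) :
    expandLabel m i x + labelSum (mapNodes (expandLabel m) (i + 1) r) + m * (r.numNodes + 1) =
      m * (x + labelSum r) + r.numNodes + (i % m + 1) := by
  have h1 := labelSum_mapNodes_expandLabel hr
  have h2 := expandLabel_add hx
  -- The right subtree ends at a multiple of `m`, so only the floor at its start survives; this
  -- leaves the remainder `i % m`.
  have h3 := Nat.mul_div_cancel' hd
  have h4 := Nat.div_add_mod i m
  simp only [Nat.mul_add]
  omega

theorem dvd_of_positiveOffMultiples_node {m j x : ℕ} {l r : BinaryTree ℕ}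
    (h : PositiveOffMultiples m j (childCounts (shape (.node x l r)))) :
    m ∣ j + l.numNodes + 1 + r.numNodes := by
  have := h.dvd (by simp)
  rw [numNodes_shape, BinaryTree.numNodes] at this
  convert this using 1
  omega

/-- By `expand_node_bound`, the expanded inequality at a node is the original one multiplied by `m`,
up to an error `i % m + 1` between `1` and `m`. The error is too small to change its truth. -/
theorem isGraftingTree_mapNodes_expandLabel {m j : ℕ} (hm : 1 ≤ m) {G : BinaryTree ℕ}
    (h : PositiveOffMultiples m j (labels G))
    (h' : PositiveOffMultiples m j (childCounts (shape G))) :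
    IsGraftingTree (mapNodes (expandLabel m) j G) ↔ IsGraftingTree G := by
  induction G generalizing j with
  | nil => rfl
  | node x l r hl hr =>
    have hd := dvd_of_positiveOffMultiples_node h'
    rw [positiveOffMultiples_node] at h
    rw [shape_node, positiveOffMultiples_childCounts_node, numNodes_shape] at h'
    have hb := expand_node_bound h.2.1 h.2.2 hd
    refine and_congr ?_ (and_congr (hl h.1 h'.1) (hr h.2.2 h'.2.2))
    rw [numNodes_mapNodes]
    have hlt := Nat.mod_lt (j + l.numNodes) hm
    constructor
    · intro hle
      by_contra hc
      have := Nat.mul_le_mul_left m (show r.numNodes + 1 ≤ x + labelSum r by omega)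
      omega
    · intro hle
      have := Nat.mul_le_mul_left m hle
      rw [Nat.mul_add m r.numNodes] at hb
      omega

/-- The slack of a node is multiplied by `m`, and the correction added to it depends only on its
index. The total correction is thus the same for all intervals of a given size. -/
theorem labelDefect_mapNodes_expandLabel {m j : ℕ} (hm : 1 ≤ m) {G : BinaryTree ℕ}
    (hG : IsGraftingTree G) (h : PositiveOffMultiples m j (labels G)) :
    labelDefect (mapNodes (expandLabel m) j G) =
      m * labelDefect G + ∑ i ∈ Finset.range G.numNodes, (m - 1 - (j + i) % m) := by
  induction G generalizing j with
  | nil => simp [mapNodes, labelDefect]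
  | node x l r hl hr =>
    have hd := dvd_of_positiveOffMultiples_node (h.shape hG)
    rw [positiveOffMultiples_node] at h
    have hb := expand_node_bound h.2.1 h.2.2 hd
    have hlt := Nat.mod_lt (j + l.numNodes) hm
    obtain ⟨y, hy⟩ := Nat.exists_eq_add_of_le hG.1
    have hs : ∑ i ∈ Finset.range (l.numNodes + r.numNodes + 1), (m - 1 - (j + i) % m) =
        ∑ i ∈ Finset.range l.numNodes, (m - 1 - (j + i) % m) + (m - 1 - (j + l.numNodes) % m) +
          ∑ i ∈ Finset.range r.numNodes, (m - 1 - (j + l.numNodes + 1 + i) % m) := by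
      rw [Nat.add_right_comm, Finset.sum_range_add, Finset.sum_range_succ]
      simp only [Nat.add_assoc]
    simp only [mapNodes, labelDefect, BinaryTree.numNodes, hs, hl hG.2.1 h.1, hr hG.2.2 h.2.2,
      numNodes_mapNodes]
    rw [show r.numNodes - labelSum r - x = y by omega]
    have hy' : m * (r.numNodes + 1) = m * (x + labelSum r) + m * y + m := by rw [hy]; ring
    rw [Nat.mul_add m (_ + _), Nat.mul_add m (labelDefect l)]
    omega

theorem dvd_labels_mapNodes_expandLabel {m j : ℕ} {G : BinaryTree ℕ} :
    ∀ x ∈ labels (mapNodes (expandLabel m) j G), m ∣ x := by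
  induction G generalizing j with
  | nil => simp [mapNodes, labels]
  | node x l r hl hr =>
    simp only [mapNodes, labels, List.mem_append, List.mem_cons]
    rintro y (h | rfl | h)
    exacts [hl y h, dvd_expandLabel _ _ _, hr y h]

theorem positiveOffMultiples_mapNodes_contractLabel {m j : ℕ} {G : BinaryTree ℕ} :
    PositiveOffMultiples m j (labels (mapNodes (contractLabel m) j G)) := by
  induction G generalizing j with
  | nil => trivial
  | node x l r hl hr =>
    simp only [mapNodes, positiveOffMultiples_node, numNodes_mapNodes]
    refine ⟨hl, fun hd => ?_, hr⟩
    simp [contractLabel, hd]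

theorem mapNodes_contractLabel_expandLabel {m j : ℕ} (hm : 1 ≤ m) {G : BinaryTree ℕ}
    (h : PositiveOffMultiples m j (labels G)) :
    mapNodes (contractLabel m) j (mapNodes (expandLabel m) j G) = G := by
  induction G generalizing j with
  | nil => rfl
  | node x l r hl hr =>
    rw [positiveOffMultiples_node] at h
    simp only [mapNodes, numNodes_mapNodes, hl h.1, hr h.2.2, expandLabel, contractLabel]
    congr 1
    split
    · exact Nat.mul_div_cancel_left _ hm
    · rename_i hd
      have := h.2.1 hd
      rw [Nat.mul_div_cancel_left _ hm]
      omega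

theorem mapNodes_expandLabel_contractLabel {m j : ℕ} {G : BinaryTree ℕ}
    (h : ∀ x ∈ labels G, m ∣ x) :
    mapNodes (expandLabel m) j (mapNodes (contractLabel m) j G) = G := by
  induction G generalizing j with
  | nil => rfl
  | node x l r hl hr =>
    simp only [labels, List.mem_append, List.mem_cons] at h
    simp only [mapNodes, numNodes_mapNodes, hl fun x hx => h x (.inl hx),
      hr fun x hx => h x (.inr (.inr hx)), expandLabel, contractLabel]
    have := Nat.mul_div_cancel' (h x (.inr (.inl rfl)))
    congr 1
    split <;> simp [this]

/-! ### Contacts -/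

theorem contactsFrom_treeToDyck_append (t : BinaryTree Unit) (h : ℕ) (w : Path) :
    contactsFrom 1 h (treeToDyck t ++ w) =
      (if h = 0 then leftBranchLength t else 0) + contactsFrom 1 h w := by
  induction t generalizing h w with
  | nil => simp [treeToDyck, leftBranchLength]
  | node _ l r hl hr =>
    simp only [treeToDyck, List.append_assoc, List.cons_append, hl, contactsFrom, hr,
      List.nil_append, leftBranchLength]
    split <;> simp; omega

@[simp] theorem contactValue_treeToDyck (t : BinaryTree Unit) :
    contactValue 1 (treeToDyck t) = leftBranchLength t := by
  have := contactsFrom_treeToDyck_append t 0 []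
  simpa [contactsFrom, contactValue] using this

theorem innerContacts_one_cons_true (w : Path) :
    innerContacts 1 (true :: w) = contactsFrom 1 0 w :: innerContacts 1 w := by
  simp [innerContacts]

/-- After the up step of a node, the path traces the right subtree and then goes below the line; the
contacts in between are the children of the node. -/
theorem innerContacts_treeToDyck_append (t : BinaryTree Unit) (w : Path) :
    innerContacts 1 (treeToDyck t ++ w) = childCounts t ++ innerContacts 1 w := by
  induction t generalizing w with
  | nil => rfl
  | node _ l r hl hr =>
    simp only [treeToDyck, List.append_assoc, List.cons_append, hl, innerContacts_one_cons_true,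
      hr, contactsFrom_treeToDyck_append, List.nil_append, childCounts]
    simp [contactsFrom, innerContacts]

@[simp] theorem innerContacts_treeToDyck (t : BinaryTree Unit) :
    innerContacts 1 (treeToDyck t) = childCounts t := by
  have := innerContacts_treeToDyck_append t []
  simpa [innerContacts] using this

theorem exists_childCounts_eq_append_zero {t : BinaryTree Unit} (ht : t ≠ .nil) :
    ∃ L, childCounts t = L ++ [0] := by
  induction t with
  | nil => exact absurd rfl ht
  | node _ l r _ hr =>
    by_cases h : r = .nil
    · subst h
      exact ⟨childCounts l, rfl⟩
    · obtain ⟨L, hL⟩ := hr h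
      exact ⟨childCounts l ++ leftBranchLength r :: L, by simp [childCounts, hL]⟩

/-- Adding `0` restores the entry removed by `dropLast`. For the empty tree, that entry is the
contact value itself. -/
theorem zero_cons_contactVector_treeToDyck (t : BinaryTree Unit) :
    0 ::ₘ (contactVector 1 (treeToDyck t) : Multiset ℕ) =
      leftBranchLength t ::ₘ (childCounts t : Multiset ℕ) := by
  rw [contactVector, contactValue_treeToDyck, innerContacts_treeToDyck]
  by_cases ht : t = .nil
  · subst ht; rfl
  · obtain ⟨L, hL⟩ := exists_childCounts_eq_append_zero ht
    rw [hL, ← List.cons_append, List.dropLast_concat, Multiset.cons_coe, Multiset.cons_coe,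
      Multiset.coe_eq_coe, ← List.cons_append]
    exact (List.perm_append_singleton 0 _).symm

/-! ### Rises -/

/-- The initial rise of the Dyck path of a binary tree. -/
def firstRise : BinaryTree Unit → ℕ
  | .nil => 0
  | .node _ l r => if l = .nil then firstRise r + 1 else firstRise l

/-- The rises of the Dyck path of a binary tree other than the initial one, together with `0`
unless the tree is empty. -/
def otherRises : BinaryTree Unit → Multiset ℕ
  | .nil => 0
  | .node _ l r =>
      if l = .nil then 0 ::ₘ otherRises r
      else otherRises l + (firstRise r + 1) ::ₘ otherRises r

/-- An empty left subtree contributes a single `0`, so the case distinction in the definitions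
disappears from the full multiset. -/
theorem firstRise_cons_otherRises_node (l r : BinaryTree Unit) :
    firstRise (.node () l r) ::ₘ otherRises (.node () l r) =
      (firstRise l ::ₘ otherRises l) + (firstRise r + 1) ::ₘ otherRises r := by
  by_cases hl : l = .nil
  · subst hl
    simp [firstRise, otherRises, Multiset.cons_swap]
  · simp only [firstRise, otherRises, hl, if_false, ← Multiset.singleton_add]
    abel

theorem riseVectorAux_concat_append (k : ℕ) (u w : Path) :
    riseVectorAux k (u ++ [false] ++ w) = riseVectorAux k (u ++ [false]) ++ riseVectorAux 0 w := by
  induction u generalizing k with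
  | nil => rfl
  | cons b u ih => cases b <;> simpa [riseVectorAux] using ih _

theorem riseVectorAux_treeToDyck_append {t : BinaryTree Unit} (ht : t ≠ .nil) (k : ℕ) (w : Path) :
    riseVectorAux k (treeToDyck t ++ w) = riseVectorAux k (treeToDyck t) ++ riseVectorAux 0 w := by
  cases t with
  | nil => exact absurd rfl ht
  | node _ l r =>
    rw [treeToDyck, ← List.cons_append, ← List.append_assoc]
    exact riseVectorAux_concat_append _ _ _

theorem riseVectorAux_treeToDyck (t : BinaryTree Unit) (k : ℕ) (w : Path) :
    (riseVectorAux k (treeToDyck t ++ false :: w) : Multiset ℕ) =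
      (k + firstRise t) ::ₘ (otherRises t + riseVectorAux 0 w) := by
  induction t generalizing k w with
  | nil => simp [treeToDyck, riseVectorAux, firstRise, otherRises]
  | node _ l r hl hr =>
    by_cases h : l = .nil
    · subst h
      simp only [treeToDyck, List.nil_append, List.cons_append, List.append_assoc, riseVectorAux,
        hr, firstRise, otherRises, ← Multiset.cons_coe]
      simp only [if_true, Multiset.cons_add, Multiset.add_cons, Nat.add_assoc, Nat.add_comm 1]
    -- The down step after D(l) records an empty run: this is the `0` in `otherRises l`, which must
    -- be cancelled below.
    · have h1 := hl k []
      rw [riseVectorAux_treeToDyck_append h, ← Multiset.coe_add] at h1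
      simp only [treeToDyck, List.append_assoc, List.cons_append, List.nil_append]
      rw [riseVectorAux_treeToDyck_append h, ← Multiset.coe_add, riseVectorAux, hr, riseVectorAux,
        ← Multiset.cons_coe]
      simp only [firstRise, otherRises, h, if_false, Nat.zero_add, Nat.add_comm 1]
      simp only [riseVectorAux, ← Multiset.cons_coe, Multiset.coe_nil,
        ← Multiset.singleton_add, add_zero] at h1 ⊢
      calc _ = (riseVectorAux k (treeToDyck l) + {0}) + ({firstRise r + 1} + otherRises r +
              (riseVectorAux 0 w : Multiset ℕ)) := by abel
        _ = _ := by rw [h1]; abel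

theorem zero_cons_riseVector_treeToDyck (t : BinaryTree Unit) :
    0 ::ₘ (riseVector (treeToDyck t) : Multiset ℕ) = firstRise t ::ₘ otherRises t := by
  by_cases ht : t = .nil
  · subst ht; rfl
  have := riseVectorAux_treeToDyck t 0 []
  rw [riseVectorAux_treeToDyck_append ht, ← Multiset.coe_add] at this
  simp only [riseVectorAux, ← Multiset.cons_coe, Multiset.coe_nil, ← Multiset.singleton_add,
    add_zero, Nat.zero_add] at this ⊢
  rw [← this, add_comm]
  rfl

theorem initialRise_treeToDyck_append (t : BinaryTree Unit) (w : Path) :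
    initialRise (treeToDyck t ++ false :: w) = firstRise t := by
  induction t generalizing w with
  | nil => rfl
  | node _ l r hl hr =>
    by_cases h : l = .nil
    · subst h
      have := hr (false :: w)
      simpa [treeToDyck, firstRise, initialRise] using this
    · have hw : ∀ w, initialRise (treeToDyck l ++ w) = initialRise (treeToDyck l) := by
        intro w
        obtain h' | ⟨v, hv⟩ := treeToDyck_eq_nil_or l
        · cases l with
          | nil => exact absurd rfl h
          | node _ a b => simp [treeToDyck] at h'
        · rw [hv]
          unfold initialRise
          congr 1
          clear hv
          induction v with
          | nil => simp
          | cons b v ih => cases b <;> simp_all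
      have := hl []
      rw [hw] at this
      simp only [treeToDyck, List.append_assoc, hw, this, firstRise, h, if_false]

theorem initialRise_treeToDyck (t : BinaryTree Unit) :
    initialRise (treeToDyck t) = firstRise t := by
  have h : ∀ w : Path, initialRise (w ++ [false]) = initialRise w := by
    intro w
    induction w with
    | nil => rfl
    | cons b w ih => cases b <;> simp_all [initialRise]
  rw [← h, initialRise_treeToDyck_append]

/-- Reversing left branches turns maximal sequences of up steps into right branches. -/
theorem rises_reverseLeftBranchesAux (G H : BinaryTree ℕ) :
    (0 ::ₘ leftBranchLength (mirror (shape (reverseLeftBranchesAux G H))) ::ₘ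
        (childCounts (mirror (shape (reverseLeftBranchesAux G H))) : Multiset ℕ) =
      (firstRise (shape G) ::ₘ otherRises (shape G)) +
        leftBranchLength (mirror (shape H)) ::ₘ (childCounts (mirror (shape H)) : Multiset ℕ)) ∧
    leftBranchLength (mirror (shape (reverseLeftBranchesAux G H))) =
      if G = .nil then leftBranchLength (mirror (shape H)) else firstRise (shape G) := by
  induction G generalizing H with
  | nil => simp [reverseLeftBranchesAux, firstRise, otherRises]
  | node x l r hl hr =>
    obtain ⟨h1, h2⟩ := hr .nil
    have h2' : leftBranchLength (mirror (shape (reverseLeftBranchesAux r .nil))) =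
        firstRise (shape r) := by
      rw [h2]
      split
      · simp_all [firstRise, mirror, leftBranchLength]
      · rfl
    have h1' : (childCounts (mirror (shape (reverseLeftBranchesAux r .nil))) : Multiset ℕ) =
        otherRises (shape r) := by
      rw [h2'] at h1
      simp only [shape_nil, mirror, leftBranchLength, childCounts, Multiset.coe_nil,
        ← Multiset.singleton_add, add_zero] at h1
      rw [add_comm, add_right_cancel_iff, add_left_cancel_iff] at h1
      exact h1
    -- The root goes onto the accumulator. Its run continues with the bottom of the left branch of
    -- `r`, now the root of its reversed right subtree; this accounts for the added `1`. The
    -- accumulated `H` on its left starts a separate right branch.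
    obtain ⟨k1, k2⟩ := hl (.node x H (reverseLeftBranchesAux r .nil))
    rw [reverseLeftBranchesAux]
    constructor
    · rw [k1, shape_node, shape_node, firstRise_cons_otherRises_node]
      simp only [mirror, leftBranchLength, childCounts, ← Multiset.coe_add, ← Multiset.cons_coe,
        h1', h2', ← Multiset.singleton_add]
      abel
    · rw [k2]
      by_cases h : l = .nil
      · simp [h, mirror, leftBranchLength, firstRise, h2']
      · simp [h, firstRise]

theorem leftBranchLength_mirror_reverseLeftBranches (G : BinaryTree ℕ) :
    leftBranchLength (mirror (shape (reverseLeftBranches G))) = firstRise (shape G) := by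
  rw [reverseLeftBranches, (rises_reverseLeftBranchesAux G .nil).2]
  split
  · simp_all [firstRise, mirror, leftBranchLength]
  · rfl

theorem childCounts_mirror_reverseLeftBranches (G : BinaryTree ℕ) :
    (childCounts (mirror (shape (reverseLeftBranches G))) : Multiset ℕ) =
      otherRises (shape G) := by
  have h1 := (rises_reverseLeftBranchesAux G .nil).1
  have h2 := leftBranchLength_mirror_reverseLeftBranches G
  rw [reverseLeftBranches] at h2 ⊢
  rw [h2] at h1
  simp only [shape_nil, mirror, leftBranchLength, childCounts, Multiset.coe_nil,
    ← Multiset.singleton_add, add_zero] at h1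
  rw [add_comm, add_right_cancel_iff, add_left_cancel_iff] at h1
  exact h1

/-! ### The rise-contact involution on Tamari intervals -/

/-- The number of roots is the size minus the sum of the labels, and Φ keeps both. -/
theorem IsTreeInterval.leftBranchLength_leftBranchInvolution
    {I : BinaryTree Unit × BinaryTree Unit} (h : IsTreeInterval I) :
    leftBranchLength (MTamari.leftBranchInvolution I).1 = leftBranchLength I.1 := by
  have h1 := leftBranchLength_lowerTree h.isGraftingTree
  have h2 := leftBranchLength_lowerTree h.isGraftingTree.reverseLeftBranches
  have h3 := congrArg Prod.fst h.ungraft_graft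
  rw [labelSum_reverseLeftBranches, numNodes_reverseLeftBranches, ← h1] at h2
  simp only [ungraft] at h3
  rw [h3] at h2
  exact Nat.add_right_cancel h2

theorem IsTreeInterval.childCounts_leftBranchInvolution
    {I : BinaryTree Unit × BinaryTree Unit} (h : IsTreeInterval I) :
    (childCounts (MTamari.leftBranchInvolution I).1 : Multiset ℕ) = childCounts I.1 := by
  rw [MTamari.leftBranchInvolution, ungraft,
    childCounts_lowerTree h.isGraftingTree.reverseLeftBranches, labels_reverseLeftBranches,
    labels_graft h.numNodes_eq]

/-- The outer Φ does not affect contacts, so they can be read on the mirror image of the upper tree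
of Φ(I), whose left branches are the runs of up steps of `I.2`. -/
theorem IsTreeInterval.contactValue_riseContact {I : BinaryTree Unit × BinaryTree Unit}
    (h : IsTreeInterval I) :
    contactValue 1 (treeToDyck (MTamari.riseContact I).1) = initialRise (treeToDyck I.2) := by
  rw [contactValue_treeToDyck, initialRise_treeToDyck, MTamari.riseContact,
    h.leftBranchInvolution.complement.leftBranchLength_leftBranchInvolution]
  change leftBranchLength (mirror (shape (reverseLeftBranches (graft I)))) = _
  rw [leftBranchLength_mirror_reverseLeftBranches, graft, shape_relabel]

theorem IsTreeInterval.contactVector_riseContact {I : BinaryTree Unit × BinaryTree Unit}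
    (h : IsTreeInterval I) :
    (contactVector 1 (treeToDyck (MTamari.riseContact I).1) : Multiset ℕ) =
      riseVector (treeToDyck I.2) := by
  rw [← Multiset.cons_inj_right 0, zero_cons_contactVector_treeToDyck,
    zero_cons_riseVector_treeToDyck, ← initialRise_treeToDyck, ← h.contactValue_riseContact,
    contactValue_treeToDyck]
  congr 1
  rw [MTamari.riseContact, h.leftBranchInvolution.complement.childCounts_leftBranchInvolution]
  change (childCounts (mirror (shape (reverseLeftBranches (graft I)))) : Multiset ℕ) = _
  rw [childCounts_mirror_reverseLeftBranches, graft, shape_relabel]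

theorem IsTreeInterval.riseVector_riseContact {I : BinaryTree Unit × BinaryTree Unit}
    (h : IsTreeInterval I) :
    (riseVector (treeToDyck (MTamari.riseContact I).2) : Multiset ℕ) =
      contactVector 1 (treeToDyck I.1) := by
  rw [← h.riseContact.contactVector_riseContact, h.riseContact_riseContact]

/-! ### Divisibility -/

theorem one_le_contactsFrom_zero {w : Path} : 1 ≤ contactsFrom 1 0 w ↔ w.head? = some true := by
  rcases w with _ | ⟨_ | _, w⟩ <;> simp [contactsFrom]

/-- Here `j` counts all up steps read and `k` those of the current run. An up step has a contact
exactly when another up step follows it, so positivity off multiples lets runs end only when `m`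
divides `j`. Resetting `k` to zero at a down step then keeps `j` and `k` equivalent for divisibility
by `m`. -/
theorem positiveOffMultiples_innerContacts {m j k : ℕ} (w : Path) (h : m ∣ j ↔ m ∣ k)
    (h' : ∀ i, m ∣ j + i ↔ m ∣ k + i) :
    (¬ m ∣ j → w.head? = some true) ∧ PositiveOffMultiples m j (innerContacts 1 w) ↔
      (∀ r ∈ riseVectorAux k w, m ∣ r) ∧ m ∣ j + w.count true := by
  induction w generalizing j k with
  | nil => simp [innerContacts, PositiveOffMultiples, riseVectorAux]
  | cons b w ih =>
    cases b with
    | true =>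
      rw [innerContacts_one_cons_true, PositiveOffMultiples, one_le_contactsFrom_zero,
        ih (k := k + 1) (h' 1) fun i => by rw [Nat.add_assoc, h', Nat.add_assoc]]
      simp [riseVectorAux, Nat.add_assoc, Nat.add_comm 1]
    | false =>
      simp only [innerContacts, riseVectorAux, List.head?_cons, List.mem_cons, forall_eq_or_imp,
        Option.some.injEq, Bool.false_eq_true, imp_false, not_not, ← h]
      rw [and_assoc]
      refine and_congr_right fun hj => ?_
      rw [List.count_cons_of_ne (by simp), ← ih (k := 0) (by simp [hj])
        fun i => by rw [Nat.zero_add]; exact Nat.dvd_add_right hj]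
      simp [hj]

theorem positiveOffMultiples_childCounts {m n : ℕ} {t : BinaryTree Unit}
    (h : t.numNodes = n * m) :
    PositiveOffMultiples m 0 (childCounts t) ↔ ∀ r ∈ riseVector (treeToDyck t), m ∣ r := by
  have := positiveOffMultiples_innerContacts (m := m) (j := 0) (k := 0) (treeToDyck t) Iff.rfl
    fun _ => Iff.rfl
  simpa [count_treeToDyck, h, riseVector] using this

/-- The only nonzero contact that might not be a label is the contact value. It equals `n * m` minus
the sum of the labels, so its divisibility is automatic. -/
theorem dvd_contactVector_iff {m n : ℕ} {G : BinaryTree ℕ} (hG : IsGraftingTree G)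
    (h : G.numNodes = n * m) :
    (∀ c ∈ contactVector 1 (treeToDyck (lowerTree G)), m ∣ c) ↔ ∀ x ∈ labels G, m ∣ x := by
  have h1 := zero_cons_contactVector_treeToDyck (lowerTree G)
  have h2 := leftBranchLength_lowerTree hG
  rw [childCounts_lowerTree hG] at h1
  have h3 : (∀ c ∈ contactVector 1 (treeToDyck (lowerTree G)), m ∣ c) ↔
      ∀ c ∈ 0 ::ₘ (contactVector 1 (treeToDyck (lowerTree G)) : Multiset ℕ), m ∣ c := by
    simp
  rw [h3, h1]
  simp only [Multiset.mem_cons, forall_eq_or_imp, Multiset.mem_coe, and_iff_right_iff_imp]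
  intro hd
  rw [labelSum_eq] at h2
  have := List.dvd_sum hd
  rw [← Nat.dvd_add_left this, h2, h]
  exact Nat.dvd_mul_left _ _

theorem mem_mDivisibleGraftingTrees {m n : ℕ} {G : BinaryTree ℕ} :
    G ∈ mDivisibleGraftingTrees m n ↔ IsGraftingTree G ∧ G.numNodes = n * m ∧
      (∀ x ∈ labels G, m ∣ x) ∧ PositiveOffMultiples m 0 (childCounts (shape G)) := by
  refine and_congr_right fun hG => and_congr_right fun h => and_congr ?_ ?_
  · exact dvd_contactVector_iff hG h
  · exact (positiveOffMultiples_childCounts (by simpa [ungraft] using h)).symm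

/-! ### Expansion and contraction as inverse bijections -/

theorem expand_mem {m n : ℕ} (hm : 1 ≤ m) {G : BinaryTree ℕ} (hG : G ∈ mGraftingTrees m n) :
    expand m G ∈ mDivisibleGraftingTrees m n := by
  rw [mem_mGraftingTrees] at hG
  obtain ⟨h1, h2, h3⟩ := hG
  rw [mem_mDivisibleGraftingTrees, expand_eq_mapNodes, numNodes_mapNodes, shape_mapNodes,
    isGraftingTree_mapNodes_expandLabel hm h3 (h3.shape h1)]
  exact ⟨h1, h2, dvd_labels_mapNodes_expandLabel, h3.shape h1⟩

theorem contract_expand {m n : ℕ} (hm : 1 ≤ m) {G : BinaryTree ℕ} (hG : G ∈ mGraftingTrees m n) :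
    contract m (expand m G) = G := by
  rw [contract_eq_mapNodes, expand_eq_mapNodes]
  exact mapNodes_contractLabel_expandLabel hm (mem_mGraftingTrees.1 hG).2.2

theorem expand_contract {m n : ℕ} {G : BinaryTree ℕ} (hG : G ∈ mDivisibleGraftingTrees m n) :
    expand m (contract m G) = G := by
  rw [contract_eq_mapNodes, expand_eq_mapNodes]
  exact mapNodes_expandLabel_contractLabel (mem_mDivisibleGraftingTrees.1 hG).2.2.1

theorem contract_mem {m n : ℕ} (hm : 1 ≤ m) {G : BinaryTree ℕ}
    (hG : G ∈ mDivisibleGraftingTrees m n) : contract m G ∈ mGraftingTrees m n := by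
  have he := expand_contract hG
  rw [mem_mDivisibleGraftingTrees] at hG
  obtain ⟨h1, h2, h3, h4⟩ := hG
  rw [contract_eq_mapNodes, expand_eq_mapNodes] at he
  rw [mem_mGraftingTrees, contract_eq_mapNodes, numNodes_mapNodes]
  refine ⟨?_, h2, positiveOffMultiples_mapNodes_contractLabel⟩
  -- The contracted tree is a grafting tree because its expansion is `G`.
  rwa [← isGraftingTree_mapNodes_expandLabel hm positiveOffMultiples_mapNodes_contractLabel
    (by rwa [shape_mapNodes]), he]

theorem labelDefect_expand {m n : ℕ} (hm : 1 ≤ m) {G : BinaryTree ℕ}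
    (hG : G ∈ mGraftingTrees m n) :
    labelDefect (expand m G) =
      m * labelDefect G + ∑ i ∈ Finset.range (n * m), (m - 1 - i % m) := by
  rw [mem_mGraftingTrees] at hG
  rw [expand_eq_mapNodes, labelDefect_mapNodes_expandLabel hm hG.1 hG.2.2, hG.2.1]
  simp

/-! ### Contacts of ballot paths -/

theorem contactsFrom_replicate_append (h i : ℕ) (w : Path) :
    contactsFrom 1 h (List.replicate i true ++ w) =
      (if h = 0 ∧ i ≠ 0 then 1 else 0) + contactsFrom 1 (h + i) w := by
  induction i generalizing h with
  | zero => simp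
  | succ i ih =>
    rw [List.replicate_succ, List.cons_append, contactsFrom, ih]
    simp [Nat.add_assoc, Nat.add_comm 1]

theorem contactsFrom_ballotToDyck {m : ℕ} (hm : 1 ≤ m) (h : ℕ) (w : Path) :
    contactsFrom 1 h (ballotToDyck m w) = contactsFrom m h w := by
  induction w generalizing h with
  | nil => cases h <;> rfl
  | cons b w ih =>
    cases b with
    | true =>
      rw [ballotToDyck_true, contactsFrom_replicate_append, ih]
      simp [contactsFrom, show m ≠ 0 by omega]
    | false => cases h <;> simp [contactsFrom, ih]

theorem innerContacts_replicate_append (i : ℕ) (w : Path) :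
    innerContacts 1 (List.replicate i true ++ w) =
      (List.range i).map (fun a => contactsFrom 1 0 (List.replicate (i - (a + 1)) true ++ w)) ++
        innerContacts 1 w := by
  induction i with
  | zero => simp
  | succ i ih =>
    rw [List.replicate_succ, List.cons_append, innerContacts_one_cons_true, ih,
      List.range_succ_eq_map]
    simp [Function.comp_def]

/-- An up step that is not the last of its block has one extra contact, where the next up step of
the block starts. This is the unit that `expand` subtracts off the multiples of `m`. -/
theorem expandLabel_contactsFrom {m j a : ℕ} (hm : 1 ≤ m) (hj : m ∣ j) (ha : a < m) (w : Path) :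
    expandLabel m (j + a)
        (contactsFrom 1 0 (List.replicate (m - (a + 1)) true ++ ballotToDyck m w)) =
      m * contactsFrom m (m - (a + 1)) w := by
  rw [contactsFrom_replicate_append, Nat.zero_add, contactsFrom_ballotToDyck hm, expandLabel]
  simp only [Nat.add_assoc, Nat.dvd_add_right hj]
  by_cases h : a + 1 = m
  · simp [h]
  · have hd : ¬ m ∣ a + 1 := Nat.not_dvd_of_pos_of_lt (by omega) (by omega)
    simp [hd, show m - (a + 1) ≠ 0 by omega]

theorem mapIdx_innerContacts_ballotToDyck {m j : ℕ} (hm : 1 ≤ m) (hj : m ∣ j) (w : Path) :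
    (innerContacts 1 (ballotToDyck m w)).mapIdx (fun k => expandLabel m (j + k)) =
      (innerContacts m w).map (m * ·) := by
  induction w generalizing j with
  | nil => rfl
  | cons b w ih =>
    cases b with
    | false => exact ih hj
    | true =>
      rw [ballotToDyck_true, innerContacts_replicate_append, List.mapIdx_append, innerContacts,
        List.map_append]
      congr 1
      · apply List.ext_getElem
        · simp
        · intro a h1 h2
          simp only [List.getElem_mapIdx, List.getElem_map, List.getElem_range]
          exact expandLabel_contactsFrom hm hj (by simpa using h1) w
      · rw [← ih (j := j + m) (by simpa using hj)]
        simp [Nat.add_assoc, Nat.add_comm m]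

theorem initialRise_ballotToDyck (m : ℕ) (w : Path) :
    initialRise (ballotToDyck m w) = m * initialRise w := by
  have key : ∀ i (w : Path), initialRise (List.replicate i true ++ w) = initialRise w + i := by
    intro i
    induction i with
    | zero => simp
    | succ i ih =>
      intro w
      have := ih w
      simp [List.replicate_succ, initialRise] at this ⊢
      omega
  induction w with
  | nil => rfl
  | cons b w ih =>
    cases b with
    | true =>
      rw [ballotToDyck_true, key, ih, ← Nat.mul_succ]
      simp [initialRise]
    | false => rfl

/-! ### Intervals of the `m`-Tamari lattice as intervals of binary trees -/

theorem treeToDyck_injective : Function.Injective treeToDyck :=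
  Function.LeftInverse.injective dyckToTree_treeToDyck

theorem eq_of_treeToDyck_eq {m : ℕ} (hm : 1 ≤ m) {w w' : Path} {t : BinaryTree Unit}
    (h : treeToDyck t = ballotToDyck m w) (h' : treeToDyck t = ballotToDyck m w') : w = w' := by
  rw [← dyckToBallot_treeToDyck hm h, dyckToBallot_treeToDyck hm h']

theorem Rotation.ne {m : ℕ} {w w' : Path} (h : Rotation m w w') : w ≠ w' := by
  obtain ⟨a, b, c, hb, rfl, rfl⟩ := h
  obtain ⟨b, rfl⟩ := hb.eq_true_cons
  simp

theorem TamariLE.exists_rotationChain {m : ℕ} (hm : 1 ≤ m) {w w' : Path} (h : TamariLE m w w')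
    {s : BinaryTree Unit} (hs : treeToDyck s = ballotToDyck m w) :
    ∃ t k, treeToDyck t = ballotToDyck m w' ∧ RotationChain k s t := by
  induction h with
  | refl => exact ⟨s, 0, hs, .refl s⟩
  | tail _ h ih =>
    obtain ⟨t, k, ht, hk⟩ := ih
    obtain ⟨a, b, c, hb, h1, h2⟩ := h.ballotToDyck hm
    obtain ⟨u, hu, htu⟩ := exists_treeRotation hb (ht.trans h1)
    exact ⟨u, k + 1, hu.trans h2.symm, hk.trans (.single htu)⟩

theorem RotationChain.exists_rotations {m k : ℕ} (hm : 1 ≤ m) {s t : BinaryTree Unit}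
    (h : RotationChain k s t) {w : Path} (hw : treeToDyck s = ballotToDyck m w) :
    ∃ c : ℕ → Path, c 0 = w ∧ treeToDyck t = ballotToDyck m (c k) ∧
      ∀ i < k, Rotation m (c i) (c (i + 1)) := by
  induction h generalizing w with
  | refl => exact ⟨fun _ => w, rfl, hw, by simp⟩
  | head h _ ih =>
    have h1 := h.rotation
    rw [hw] at h1
    obtain ⟨w', hw', hr⟩ := exists_rotation_of_ballotToDyck hm h1
    obtain ⟨c, rfl, h2, h3⟩ := ih hw'.symm
    refine ⟨fun i => Nat.casesOn i w c, rfl, h2, fun i hi => ?_⟩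
    cases i with
    | zero => exact hr
    | succ i => exact h3 i (by omega)

theorem tamariLE_of_rotations {m k : ℕ} {c : ℕ → Path} (h : ∀ i < k, Rotation m (c i) (c (i + 1))) :
    TamariLE m (c 0) (c k) := by
  induction k with
  | zero => exact .refl
  | succ k ih => exact (ih fun i hi => h i (by omega)).tail (h k (by omega))

/-- The pair of binary trees of an interval of the `m`-Tamari lattice. -/
def treePair (m : ℕ) (I : Path × Path) : BinaryTree Unit × BinaryTree Unit :=
  (dyckToTree (ballotToDyck m I.1), dyckToTree (ballotToDyck m I.2))

theorem treeToDyck_dyckToTree_ballotToDyck {m n : ℕ} {w : Path} (h : IsBallotPath m n w) :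
    treeToDyck (dyckToTree (ballotToDyck m w)) = ballotToDyck m w :=
  treeToDyck_dyckToTree h.ballotToDyck

theorem numNodes_dyckToTree_ballotToDyck {m n : ℕ} {w : Path} (h : IsBallotPath m n w) :
    (dyckToTree (ballotToDyck m w)).numNodes = n * m := by
  rw [← count_treeToDyck _ true, treeToDyck_dyckToTree_ballotToDyck h]
  exact h.ballotToDyck.1

theorem isTreeInterval_treePair {m n : ℕ} (hm : 1 ≤ m) {I : Path × Path}
    (h : I ∈ intervals m n) : IsTreeInterval (treePair m I) := by
  obtain ⟨h1, h2, h3⟩ := h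
  obtain ⟨t, k, ht, hk⟩ := h3.exists_rotationChain hm (treeToDyck_dyckToTree_ballotToDyck h1)
  rw [← treeToDyck_dyckToTree_ballotToDyck h2] at ht
  rw [treeToDyck_injective ht] at hk
  exact ⟨k, hk⟩

theorem labels_graftingTree {m n : ℕ} (hm : 1 ≤ m) {I : Path × Path} (h : I ∈ intervals m n) :
    labels (graftingTree m I) = childCounts (dyckToTree (ballotToDyck m I.1)) :=
  labels_graft (isTreeInterval_treePair hm h).numNodes_eq

theorem graftingTree_mem {m n : ℕ} (hm : 1 ≤ m) {I : Path × Path} (h : I ∈ intervals m n) :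
    graftingTree m I ∈ mGraftingTrees m n := by
  have hI := isTreeInterval_treePair hm h
  have hN := numNodes_dyckToTree_ballotToDyck h.1
  refine mem_mGraftingTrees.2 ⟨hI.isGraftingTree, ?_, ?_⟩
  · rw [graftingTree, graft, numNodes_relabel]
    exact numNodes_dyckToTree_ballotToDyck h.2.1
  · rw [labels_graftingTree hm h, positiveOffMultiples_childCounts hN,
      treeToDyck_dyckToTree_ballotToDyck h.1, riseVector_ballotToDyck]
    simp

theorem ballotToDyck_dyckToBallot_treeToDyck {m n : ℕ} {t : BinaryTree Unit}
    (ht : t.numNodes = n * m) (h : PositiveOffMultiples m 0 (childCounts t)) :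
    ballotToDyck m (dyckToBallot m (treeToDyck t)) = treeToDyck t :=
  ballotToDyck_dyckToBallot (treeToDyck_eq_nil_or t) ((positiveOffMultiples_childCounts ht).1 h)

theorem ballotToDyck_intervalOf {m n : ℕ} {G : BinaryTree ℕ} (hG : G ∈ mGraftingTrees m n) :
    ballotToDyck m (intervalOf m G).1 = treeToDyck (ungraft G).1 ∧
      ballotToDyck m (intervalOf m G).2 = treeToDyck (ungraft G).2 := by
  rw [mem_mGraftingTrees] at hG
  obtain ⟨h1, h2, h3⟩ := hG
  constructor
  · apply ballotToDyck_dyckToBallot_treeToDyck (n := n)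
    · rw [← h2]; exact numNodes_lowerTree h1
    · rwa [ungraft, childCounts_lowerTree h1]
  · apply ballotToDyck_dyckToBallot_treeToDyck (n := n)
    · rw [← h2]; exact numNodes_shape G
    · exact h3.shape h1

theorem intervalOf_mem {m n : ℕ} (hm : 1 ≤ m) {G : BinaryTree ℕ} (hG : G ∈ mGraftingTrees m n) :
    intervalOf m G ∈ intervals m n := by
  obtain ⟨h1, h2⟩ := ballotToDyck_intervalOf hG
  rw [mem_mGraftingTrees] at hG
  obtain ⟨k1, k2, -⟩ := hG
  refine ⟨.of_ballotToDyck hm ?_, .of_ballotToDyck hm ?_, ?_⟩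
  · rw [h1, ← k2, ← numNodes_lowerTree k1]
    exact isBallotPath_treeToDyck _
  · rw [h2, ← k2, ← numNodes_shape]
    exact isBallotPath_treeToDyck _
  · obtain ⟨k, hk⟩ := isTreeInterval_ungraft k1
    obtain ⟨c, hc1, hc2, hc3⟩ := hk.exists_rotations hm h1.symm
    have := tamariLE_of_rotations hc3
    rwa [hc1, ← eq_of_treeToDyck_eq hm h2.symm hc2] at this

theorem graftingTree_intervalOf {m n : ℕ} {G : BinaryTree ℕ} (hG : G ∈ mGraftingTrees m n) :
    graftingTree m (intervalOf m G) = G := by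
  obtain ⟨h1, h2⟩ := ballotToDyck_intervalOf hG
  rw [graftingTree, h1, h2, dyckToTree_treeToDyck, dyckToTree_treeToDyck]
  exact graft_ungraft hG.1

theorem intervalOf_graftingTree {m n : ℕ} (hm : 1 ≤ m) {I : Path × Path}
    (h : I ∈ intervals m n) : intervalOf m (graftingTree m I) = I := by
  have hI := (isTreeInterval_treePair hm h).ungraft_graft
  rw [intervalOf, graftingTree]
  change (dyckToBallot m (treeToDyck (ungraft (graft (treePair m I))).1), dyckToBallot m
    (treeToDyck (ungraft (graft (treePair m I))).2)) = I
  rw [hI]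
  exact Prod.ext (dyckToBallot_treeToDyck hm (treeToDyck_dyckToTree_ballotToDyck h.1))
    (dyckToBallot_treeToDyck hm (treeToDyck_dyckToTree_ballotToDyck h.2.1))

theorem distance_eq {m n : ℕ} (hm : 1 ≤ m) {I : Path × Path} (h : I ∈ intervals m n) :
    distance m I = labelDefect (graftingTree m I) := by
  have hI := isTreeInterval_treePair hm h
  have h1 := treeToDyck_dyckToTree_ballotToDyck h.1
  have h2 := treeToDyck_dyckToTree_ballotToDyck h.2.1
  obtain ⟨hg, hg'⟩ := isGreatest_labelDefect hI
  refine IsGreatest.csSup_eq ⟨?_, ?_⟩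
  · obtain ⟨c, hc1, hc2, hc3⟩ := RotationChain.exists_rotations hm hg h1
    exact ⟨c, hc1, eq_of_treeToDyck_eq hm hc2 h2, fun i hi =>
      ⟨.single (hc3 i hi), (hc3 i hi).ne⟩⟩
  · rintro k ⟨c, hc1, hc2, hc3⟩
    -- Each strict step of the chain unfolds into at least one rotation, so a chain of rotations is
    -- at least as long.
    have key : ∀ i ≤ k, ∃ t j, i ≤ j ∧ treeToDyck t = ballotToDyck m (c i) ∧
        RotationChain j (treePair m I).1 t := by
      intro i
      induction i with
      | zero => exact fun _ => ⟨_, 0, le_rfl, by rw [hc1]; exact h1, .refl _⟩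
      | succ i ih =>
        intro hi
        obtain ⟨t, j, hij, ht, hj⟩ := ih (by omega)
        obtain ⟨hle, hne⟩ := hc3 i hi
        obtain ⟨u, l, hu, hl⟩ := hle.exists_rotationChain hm ht
        refine ⟨u, j + l, ?_, hu, hj.trans hl⟩
        cases hl with
        | refl => exact absurd (eq_of_treeToDyck_eq hm ht hu) hne
        | head => omega
    obtain ⟨t, j, hkj, ht, hj⟩ := key k le_rfl
    rw [hc2, ← h2] at ht
    rw [treeToDyck_injective ht] at hj
    exact hkj.trans (hg' hj)

/-! ### The statistics of the expanded interval -/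

/-- The Tamari interval of the expanded grafting tree. -/
def expandedPair (m : ℕ) (I : Path × Path) : BinaryTree Unit × BinaryTree Unit :=
  ungraft (expand m (graftingTree m I))

theorem isTreeInterval_expandedPair {m n : ℕ} (hm : 1 ≤ m) {I : Path × Path}
    (h : I ∈ intervals m n) : IsTreeInterval (expandedPair m I) :=
  isTreeInterval_ungraft (expand_mem hm (graftingTree_mem hm h)).1

theorem treeToDyck_expandedPair_snd {m n : ℕ} {I : Path × Path} (h : I ∈ intervals m n) :
    treeToDyck (expandedPair m I).2 = ballotToDyck m I.2 := by
  rw [expandedPair, ungraft, expand, shape_relabel, graftingTree, graft, shape_relabel,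
    treeToDyck_dyckToTree_ballotToDyck h.2.1]

theorem childCounts_expandedPair {m n : ℕ} (hm : 1 ≤ m) {I : Path × Path}
    (h : I ∈ intervals m n) :
    childCounts (expandedPair m I).1 = (innerContacts m I.1).map (m * ·) := by
  rw [expandedPair, ungraft, childCounts_lowerTree (expand_mem hm (graftingTree_mem hm h)).1,
    expand_eq_mapNodes, labels_mapNodes, labels_graftingTree hm h, ← innerContacts_treeToDyck,
    treeToDyck_dyckToTree_ballotToDyck h.1]
  exact mapIdx_innerContacts_ballotToDyck hm (dvd_zero m) I.1

/-- The contact value is `n * m` minus the sum of the labels; `labelSum_mapNodes_expandLabel` at `j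
= 0` says that expansion multiplies this difference by `m`. -/
theorem contactValue_expandedPair {m n : ℕ} (hm : 1 ≤ m) {I : Path × Path}
    (h : I ∈ intervals m n) :
    contactValue 1 (treeToDyck (expandedPair m I).1) = m * contactValue m I.1 := by
  have hG := graftingTree_mem hm h
  have h1 := leftBranchLength_lowerTree (expand_mem hm hG).1
  have h2 := leftBranchLength_lowerTree hG.1
  have h3 := labelSum_mapNodes_expandLabel (mem_mGraftingTrees.1 hG).2.2
  have h4 : contactValue m I.1 = leftBranchLength (lowerTree (graftingTree m I)) := by
    have := congrArg Prod.fst (isTreeInterval_treePair hm h).ungraft_graft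
    rw [contactValue, ← contactsFrom_ballotToDyck hm, ← treeToDyck_dyckToTree_ballotToDyck h.1]
    change contactValue 1 _ = _
    rw [contactValue_treeToDyck]
    exact congrArg leftBranchLength this.symm
  rw [← expand_eq_mapNodes, hG.2.1] at h3
  rw [hG.2.1, ← h4] at h2
  rw [(expand_mem hm hG).2.1] at h1
  rw [contactValue_treeToDyck]
  change leftBranchLength (lowerTree (expand m (graftingTree m I))) = _
  have h5 := congrArg (m * ·) h2
  simp only [Nat.zero_div, Nat.zero_add, Nat.mul_zero, Nat.add_zero, Nat.mul_div_cancel _ hm,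
    Nat.mul_add, Nat.mul_comm m n] at h3 h5
  omega

theorem contactVector_expandedPair {m n : ℕ} (hm : 1 ≤ m) {I : Path × Path}
    (h : I ∈ intervals m n) :
    contactVector 1 (treeToDyck (expandedPair m I).1) = (contactVector m I.1).map (m * ·) := by
  rw [contactVector, contactVector, contactValue_expandedPair hm h, innerContacts_treeToDyck,
    childCounts_expandedPair hm h, ← List.map_cons (f := (m * ·)), List.map_dropLast]

theorem initialRise_expandedPair {m n : ℕ} {I : Path × Path} (h : I ∈ intervals m n) :
    initialRise (treeToDyck (expandedPair m I).2) = m * initialRise I.2 := by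
  rw [treeToDyck_expandedPair_snd h, initialRise_ballotToDyck]

theorem riseVector_expandedPair {m n : ℕ} {I : Path × Path} (h : I ∈ intervals m n) :
    riseVector (treeToDyck (expandedPair m I).2) = (riseVector I.2).map (m * ·) := by
  rw [treeToDyck_expandedPair_snd h, riseVector_ballotToDyck]

theorem labelDefect_expandedPair {m n : ℕ} (hm : 1 ≤ m) {I : Path × Path}
    (h : I ∈ intervals m n) :
    labelDefect (graft (expandedPair m I)) =
      m * distance m I + ∑ i ∈ Finset.range (n * m), (m - 1 - i % m) := by
  have hG := graftingTree_mem hm h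
  rw [expandedPair, graft_ungraft (expand_mem hm hG).1, labelDefect_expand hm hG,
    distance_eq hm h]

/-! ### The `m`-rise-contact involution -/

theorem numNodes_leftBranchInvolution (I : BinaryTree Unit × BinaryTree Unit) :
    (leftBranchInvolution I).2.numNodes = I.2.numNodes := by
  rw [leftBranchInvolution, ungraft, numNodes_shape, numNodes_reverseLeftBranches, graft,
    numNodes_relabel]

theorem IsTreeInterval.numNodes_riseContact {I : BinaryTree Unit × BinaryTree Unit}
    (h : IsTreeInterval I) : (MTamari.riseContact I).2.numNodes = I.2.numNodes := by
  rw [MTamari.riseContact, numNodes_leftBranchInvolution,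
    MTamari.complement, numNodes_mirror, h.leftBranchInvolution.numNodes_eq,
    numNodes_leftBranchInvolution]

/-- The divisibility condition is symmetric in contacts and rises, and β exchanges them. -/
theorem graft_riseContact_mem {m n : ℕ} {I : BinaryTree Unit × BinaryTree Unit}
    (h : IsTreeInterval I) (hI : graft I ∈ mDivisibleGraftingTrees m n) :
    graft (riseContact I) ∈ mDivisibleGraftingTrees m n := by
  obtain ⟨-, h2, h3, h4⟩ := hI
  rw [h.ungraft_graft] at h3 h4
  refine ⟨h.riseContact.isGraftingTree, ?_, ?_, ?_⟩
  · rw [graft, numNodes_relabel] at h2 ⊢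
    rw [h.numNodes_riseContact, h2]
  · rw [h.riseContact.ungraft_graft]
    intro c hc
    rw [← Multiset.mem_coe, h.contactVector_riseContact] at hc
    exact h4 c hc
  · rw [h.riseContact.ungraft_graft]
    intro r hr
    rw [← Multiset.mem_coe, h.riseVector_riseContact] at hr
    exact h3 r hr

theorem graft_riseContact_expandedPair_mem {m n : ℕ} (hm : 1 ≤ m) {I : Path × Path}
    (h : I ∈ intervals m n) :
    graft (riseContact (expandedPair m I)) ∈ mDivisibleGraftingTrees m n := by
  have hE := expand_mem hm (graftingTree_mem hm h)
  refine graft_riseContact_mem (isTreeInterval_expandedPair hm h) ?_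
  rwa [expandedPair, graft_ungraft hE.1]

theorem mRiseContact_mem {m n : ℕ} (hm : 1 ≤ m) {I : Path × Path} (h : I ∈ intervals m n) :
    mRiseContact m I ∈ intervals m n :=
  intervalOf_mem hm (contract_mem hm (graft_riseContact_expandedPair_mem hm h))

/-- Expansion conjugates β_m to β. Every property of β_m below is obtained by transporting that of β
through this identity. -/
theorem expandedPair_mRiseContact {m n : ℕ} (hm : 1 ≤ m) {I : Path × Path}
    (h : I ∈ intervals m n) :
    expandedPair m (mRiseContact m I) = riseContact (expandedPair m I) := by
  have hK := graft_riseContact_expandedPair_mem hm h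
  change ungraft (expand m (graftingTree m
    (intervalOf m (contract m (graft (riseContact (expandedPair m I))))))) = _
  rw [graftingTree_intervalOf (contract_mem hm hK),
    expand_contract hK]
  exact (isTreeInterval_expandedPair hm h).riseContact.ungraft_graft

theorem mRiseContact_mRiseContact {m n : ℕ} (hm : 1 ≤ m) {I : Path × Path}
    (h : I ∈ intervals m n) : mRiseContact m (mRiseContact m I) = I := by
  have hG := graftingTree_mem hm h
  rw [mRiseContact]
  change intervalOf m (contract m (graft (riseContact (expandedPair m (mRiseContact m I))))) = I
  rw [expandedPair_mRiseContact hm h,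
    (isTreeInterval_expandedPair hm h).riseContact_riseContact, expandedPair,
    graft_ungraft (expand_mem hm hG).1, contract_expand hm hG, intervalOf_graftingTree hm h]

theorem contactValue_mRiseContact {m n : ℕ} (hm : 1 ≤ m) {I : Path × Path}
    (h : I ∈ intervals m n) : contactValue m (mRiseContact m I).1 = initialRise I.2 := by
  apply Nat.eq_of_mul_eq_mul_left hm
  rw [← contactValue_expandedPair hm (mRiseContact_mem hm h), expandedPair_mRiseContact hm h,
    (isTreeInterval_expandedPair hm h).contactValue_riseContact, initialRise_expandedPair h]

theorem contacts_mRiseContact {m n : ℕ} (hm : 1 ≤ m) {I : Path × Path}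
    (h : I ∈ intervals m n) : contacts m (mRiseContact m I) = rises I := by
  apply Multiset.map_injective (f := (m * ·)) fun a b => Nat.eq_of_mul_eq_mul_left hm
  rw [contacts, rises, Multiset.map_coe, Multiset.map_coe,
    ← contactVector_expandedPair hm (mRiseContact_mem hm h), expandedPair_mRiseContact hm h,
    (isTreeInterval_expandedPair hm h).contactVector_riseContact, riseVector_expandedPair h]

theorem initialRise_mRiseContact {m n : ℕ} (hm : 1 ≤ m) {I : Path × Path}
    (h : I ∈ intervals m n) : initialRise (mRiseContact m I).2 = contactValue m I.1 := by
  rw [← contactValue_mRiseContact hm (mRiseContact_mem hm h), mRiseContact_mRiseContact hm h]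

theorem rises_mRiseContact {m n : ℕ} (hm : 1 ≤ m) {I : Path × Path}
    (h : I ∈ intervals m n) : rises (mRiseContact m I) = contacts m I := by
  rw [← contacts_mRiseContact hm (mRiseContact_mem hm h), mRiseContact_mRiseContact hm h]

theorem distance_mRiseContact {m n : ℕ} (hm : 1 ≤ m) {I : Path × Path}
    (h : I ∈ intervals m n) : distance m (mRiseContact m I) = distance m I := by
  apply Nat.eq_of_mul_eq_mul_left hm
  have h1 := labelDefect_expandedPair hm h
  have h2 := labelDefect_expandedPair hm (mRiseContact_mem hm h)
  rw [expandedPair_mRiseContact hm h,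
    (isTreeInterval_expandedPair hm h).labelDefect_riseContact, h1] at h2
  exact (Nat.add_right_cancel h2).symm

end MTamari

theorem theorem74 (m n : ℕ) (hm : 1 ≤ m) :
    -- grafting trees encode the intervals of the `m`-Tamari lattice
    (Set.BijOn (MTamari.graftingTree m) (MTamari.intervals m n) (MTamari.mGraftingTrees m n) ∧
      Set.InvOn (MTamari.intervalOf m) (MTamari.graftingTree m)
        (MTamari.intervals m n) (MTamari.mGraftingTrees m n)) ∧
    -- `expand` and `contract` are inverse bijections
    (Set.BijOn (MTamari.expand m)
        (MTamari.mGraftingTrees m n) (MTamari.mDivisibleGraftingTrees m n) ∧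
      Set.InvOn (MTamari.contract m) (MTamari.expand m)
        (MTamari.mGraftingTrees m n) (MTamari.mDivisibleGraftingTrees m n)) ∧
    -- `β_m` is an involution on intervals that exchanges contacts and rises
    (∀ I ∈ MTamari.intervals m n,
      MTamari.mRiseContact m I ∈ MTamari.intervals m n ∧
      MTamari.mRiseContact m (MTamari.mRiseContact m I) = I ∧
      MTamari.contactValue m (MTamari.mRiseContact m I).1 = MTamari.initialRise I.2 ∧
      MTamari.initialRise (MTamari.mRiseContact m I).2 = MTamari.contactValue m I.1 ∧
      MTamari.contacts m (MTamari.mRiseContact m I) = MTamari.rises I ∧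
      MTamari.rises (MTamari.mRiseContact m I) = MTamari.contacts m I ∧
      MTamari.distance m (MTamari.mRiseContact m I) = MTamari.distance m I) ∧
    -- contacts and rises have a symmetric joint distribution, jointly with the distance
    (∀ (a b d : ℕ) (A B : Multiset ℕ),
      {I ∈ MTamari.intervals m n |
        MTamari.contactValue m I.1 = a ∧ MTamari.contacts m I = A ∧
        MTamari.initialRise I.2 = b ∧ MTamari.rises I = B ∧ MTamari.distance m I = d}.ncard =
      {I ∈ MTamari.intervals m n |
        MTamari.contactValue m I.1 = b ∧ MTamari.contacts m I = B ∧
        MTamari.initialRise I.2 = a ∧ MTamari.rises I = A ∧ MTamari.distance m I = d}.ncard) := by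
  refine ⟨?_, ?_, fun I hI => ?_, fun a b d A B => ?_⟩
  · have hinv : Set.InvOn (MTamari.intervalOf m) (MTamari.graftingTree m)
        (MTamari.intervals m n) (MTamari.mGraftingTrees m n) :=
      ⟨fun _ => MTamari.intervalOf_graftingTree hm, fun _ => MTamari.graftingTree_intervalOf⟩
    exact ⟨hinv.bijOn (fun _ => MTamari.graftingTree_mem hm) fun _ => MTamari.intervalOf_mem hm,
      hinv⟩
  · have hinv : Set.InvOn (MTamari.contract m) (MTamari.expand m)
        (MTamari.mGraftingTrees m n) (MTamari.mDivisibleGraftingTrees m n) :=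
      ⟨fun _ => MTamari.contract_expand hm, fun _ => MTamari.expand_contract⟩
    exact ⟨hinv.bijOn (fun _ => MTamari.expand_mem hm) fun _ => MTamari.contract_mem hm, hinv⟩
  · exact ⟨MTamari.mRiseContact_mem hm hI, MTamari.mRiseContact_mRiseContact hm hI,
      MTamari.contactValue_mRiseContact hm hI, MTamari.initialRise_mRiseContact hm hI,
      MTamari.contacts_mRiseContact hm hI, MTamari.rises_mRiseContact hm hI,
      MTamari.distance_mRiseContact hm hI⟩
  · have hmap : ∀ (a b : ℕ) (A B : Multiset ℕ), ∀ I ∈ {I ∈ MTamari.intervals m n |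
        MTamari.contactValue m I.1 = a ∧ MTamari.contacts m I = A ∧
        MTamari.initialRise I.2 = b ∧ MTamari.rises I = B ∧ MTamari.distance m I = d},
        MTamari.mRiseContact m I ∈ {I ∈ MTamari.intervals m n |
          MTamari.contactValue m I.1 = b ∧ MTamari.contacts m I = B ∧
          MTamari.initialRise I.2 = a ∧ MTamari.rises I = A ∧ MTamari.distance m I = d} := by
      rintro a b A B I ⟨hI, h1, h2, h3, h4, h5⟩
      refine ⟨MTamari.mRiseContact_mem hm hI, ?_, ?_, ?_, ?_, ?_⟩
      · rw [MTamari.contactValue_mRiseContact hm hI, h3]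
      · rw [MTamari.contacts_mRiseContact hm hI, h4]
      · rw [MTamari.initialRise_mRiseContact hm hI, h1]
      · rw [MTamari.rises_mRiseContact hm hI, h2]
      · rw [MTamari.distance_mRiseContact hm hI, h5]
    refine Set.ncard_congr (fun I _ => MTamari.mRiseContact m I) (hmap a b A B)
      (fun I J hI hJ h => ?_) fun I hI => ?_
    · rw [← MTamari.mRiseContact_mRiseContact hm hI.1, h,
        MTamari.mRiseContact_mRiseContact hm hJ.1]
    · exact ⟨_, hmap b a B A I hI, MTamari.mRiseContact_mRiseContact hm hI.1⟩
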